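/- Let $\{\xi_{n,j},\varepsilon_n\}_{n,j\in\mathbb N}$ be independent random variables with values in $\{0,1,2,\dots\}$ such that, for each $n$, the variables $\xi_{n,j}$, $j\ge 1$, are identically distributed with generating function $f_n(s)=\mathbf E s^{\xi_{n,1}}$. Let $Y_0=0$ and $Y_n=\sum_{j=1}^{Y_{n-1}}\xi_{n,j}+\varepsilon_n$ for $n\ge1$. Put $\overline f_n=f_n'(1)=\mathbf E\,\xi_{n,1}$ and $m_{n,k}=\mathbf E[\varepsilon_n(\varepsilon_n-1)\cdots(\varepsilon_n-k+1)]\in[0,\infty]$. Assume: (C1) $\overline f_n<1$ for all $n$, $\lim_{n\to\infty}\overline f_n=1$, and $\sum_{n\ge1}(1-\overline f_n)=\infty$; (C2) $\lim_{n\to\infty} f_n''(1)/(1-\overline f_n)=\nu\in[0,\infty)$; (C3) if $\nu>0$, then $\lim_{n\to\infty} f_n'''(1)/(1-\overline f_n)=0$. Let $\lambda_1,\lambda_2,\dots\in[0,\infty)$, and assume one of the following: (i) for some $K\ge1$, $\lim_{n\to\infty}\frac{m_{n,k}}{k!(1-\overline f_n)}=\lambda_k$ for $k=1,\dots,K$,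 and $\lambda_K=0$; in this case put $L=K-1$; (ii) $\lim_{n\to\infty}\frac{m_{n,k}}{k!(1-\overline f_n)}=\lambda_k$ for all $k\ge1$, and $\limsup_{n\to\infty}\lambda_n^{1/n}\le 1/2$; in this case put $L=\infty$. For $s\in[0,1]$ let \[ f_Y(s)=\exp\Bigl\{-\sum_{k=1}^{L}\frac{2^k\lambda_k}{\nu^k}\Bigl(\log\bigl(1+\tfrac{\nu}{2}(1-s)\bigr)+\sum_{i=1}^{k-1}(-1)^i\frac{\nu^i}{i2^i}(1-s)^i\Bigr)\Bigr\}, \] where, if $\nu=0$, the $k$-th term of the outer sum is read as its limit as $\nu\downarrow0$, namely $\lambda_k(-1)^{k+1}(1-s)^k/k$. Then the sum converges for every $s\in[0,1]$, and $Y_n$ converges in distribution, as $n\to\infty$, to a random variable $Y$ with values in $\{0,1,2,\dots\}$ and generating function $f_Y$. Moreover, the limits \[ q_j=\lim_{n\to\infty}\frac{\mathbf P(\varepsilon_n=j)}{1-\overline f_n},\qquad j=1,2,\dots, \] exist and are finite, and for all $s\in[0,1]$ \[ f_Y(s)=\exp\Bigl\{\sum_{n=1}^\infty A_n(s^n-1)\Bigr\},\qquad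 A_n=\frac{\nu^n}{n(2+\nu)^n}\sum_{j=1}^\infty q_j\Bigl[\Bigl(1+\frac2\nu\Bigr)^{\min(j,n)}-1\Bigr], \] where all the series converge ($\sum_j q_j<\infty$) and, if $\nu=0$, $A_n$ is read as its limit as $\nu\downarrow0$, namely $A_n=\frac1n\sum_{j\ge n}q_j$. -/

import Mathlib

open MeasureTheory ProbabilityTheory Filter Topology
open scoped NNReal ENNReal

noncomputable section

namespace NearlyCritical

variable {Ω : Type*} [MeasurableSpace Ω]

/-- The `k`-th factorial moment `E[X (X - 1) ⋯ (X - k + 1)] ∈ [0, ∞]` of an `ℕ`-valued random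
variable `X`. It is also the value at `s = 1` of the `k`-th derivative of the generating function
`f(s) = E s ^ X`: `f'(1)`, `f''(1)`, `f'''(1)` are the factorial moments for `k = 1, 2, 3`. -/
def factorialMoment (P : Measure Ω) (X : Ω → ℕ) (k : ℕ) : ℝ≥0∞ :=
  ∫⁻ ω, ((X ω).descFactorial k : ℝ≥0∞) ∂P

/-- The branching process with immigration. Generations are counted from `1` in the mathematics and
from `0` in the index: `ξ n j` is the number of children, in generation `n + 1`, of the `j`-th
individual of generation `n`, and `ε n` is the number of immigrants in generation `n + 1`. -/
def process (ξ : ℕ → ℕ → Ω → ℕ) (ε : ℕ → Ω → ℕ) : ℕ → Ω → ℕ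
  | 0, _ => 0
  | n + 1, ω => (∑ j ∈ Finset.range (process ξ ε n ω), ξ n j ω) + ε n ω

/-- The random variables `ξ n j`, `ε n` are measurable and mutually independent, and those of the
offspring variables that belong to the same generation are identically distributed. -/
structure Model (P : Measure Ω) (ξ : ℕ → ℕ → Ω → ℕ) (ε : ℕ → Ω → ℕ) : Prop where
  measurable_offspring : ∀ n j, Measurable (ξ n j)
  measurable_immigration : ∀ n, Measurable (ε n)
  indep : iIndepFun (Sum.elim (fun p : ℕ × ℕ => ξ p.1 p.2) ε : (ℕ × ℕ) ⊕ ℕ → Ω → ℕ) P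
  identDistrib : ∀ n j, IdentDistrib (ξ n j) (ξ n 0) P P

/-- `1 - E ξ`, for the offspring law with index `n` (used when `E ξ < 1`). -/
def meanDefect (P : Measure Ω) (ξ : ℕ → ℕ → Ω → ℕ) (n : ℕ) : ℝ≥0∞ :=
  1 - factorialMoment P (ξ n 0) 1

/-- The offspring laws: conditions (C1), (C2), (C3). All quotients are taken in `[0, ∞]`, and the
denominators are positive and finite. -/
structure NearlyCriticalOffspring (P : Measure Ω) (ξ : ℕ → ℕ → Ω → ℕ) (ν : ℝ≥0) : Prop where
  mean_lt_one : ∀ n, factorialMoment P (ξ n 0) 1 < 1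
  mean_tendsto : Tendsto (fun n => factorialMoment P (ξ n 0) 1) atTop (𝓝 1)
  defect_sum : ∑' n, meanDefect P ξ n = ∞
  second : Tendsto (fun n => factorialMoment P (ξ n 0) 2 / meanDefect P ξ n) atTop (𝓝 (ν : ℝ≥0∞))
  third : 0 < ν →
    Tendsto (fun n => factorialMoment P (ξ n 0) 3 / meanDefect P ξ n) atTop (𝓝 0)

/-- `m_{n,k} / (k! (1 - E ξ_n)) → l` as `n → ∞`, with `m_{n,k}` the factorial moments of the
immigration. -/
def ImmigrationLimit (P : Measure Ω) (ξ : ℕ → ℕ → Ω → ℕ) (ε : ℕ → Ω → ℕ) (k : ℕ) (l : ℝ≥0) :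
    Prop :=
  Tendsto (fun n => factorialMoment P (ε n) k / ((k.factorial : ℝ≥0∞) * meanDefect P ξ n)) atTop
    (𝓝 (l : ℝ≥0∞))

/-- Condition (C4): finitely many limits, the last of which vanishes. -/
structure FiniteImmigration (P : Measure Ω) (ξ : ℕ → ℕ → Ω → ℕ) (ε : ℕ → Ω → ℕ)
    (lam : ℕ → ℝ≥0) (K : ℕ) : Prop where
  one_le : 1 ≤ K
  limit : ∀ k, 1 ≤ k → k ≤ K → ImmigrationLimit P ξ ε k (lam k)
  last : lam K = 0

/-- `limsup_{n → ∞} lam_n ^ (1 / n)`, in `[0, ∞]`. -/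
def rootLimsup (lam : ℕ → ℝ≥0) : ℝ≥0∞ :=
  limsup (fun n : ℕ => (lam n : ℝ≥0∞) ^ (1 / (n : ℝ))) atTop

/-- Condition (C4'): infinitely many limits. -/
structure InfiniteImmigration (P : Measure Ω) (ξ : ℕ → ℕ → Ω → ℕ) (ε : ℕ → Ω → ℕ)
    (lam : ℕ → ℝ≥0) : Prop where
  limit : ∀ k, 1 ≤ k → ImmigrationLimit P ξ ε k (lam k)
  root : rootLimsup lam ≤ 1

/-- The `k`-th term, `k ≥ 1`, of the series for `- log f_Y(s)`:
`(2 ^ k lam_k / ν ^ k) (log (1 + (ν / 2) (1 - s)) + ∑_{i=1}^{k-1} (-1)^i ν^i / (i 2^i) (1 - s)^i)`.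
For `ν = 0` this is read as its limit as `ν ↓ 0`. -/
def logTerm (ν : ℝ≥0) (lam : ℕ → ℝ≥0) (k : ℕ) (s : ℝ) : ℝ :=
  if ν = 0 then (lam k : ℝ) * ((-1) ^ (k + 1) * (1 - s) ^ k / k)
  else 2 ^ k * (lam k : ℝ) / (ν : ℝ) ^ k *
    (Real.log (1 + (ν : ℝ) / 2 * (1 - s)) +
      ∑ i ∈ Finset.Ico 1 k, (-1) ^ i * ((ν : ℝ) ^ i / (i * 2 ^ i)) * (1 - s) ^ i)

/-- The coefficient, for `n ≥ 1`,
`A_n = ν^n / (n (2 + ν)^n) ∑_{j ≥ 1} q_j ((1 + 2 / ν) ^ min(j, n) - 1)`.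
For `ν = 0` this is read as its limit as `ν ↓ 0`, which is `(1 / n) ∑_{j ≥ n} q_j`. -/
def coeffA (ν : ℝ≥0) (q : ℕ → ℝ≥0) (n : ℕ) : ℝ :=
  if ν = 0 then 1 / (n : ℝ) * ∑' j : ℕ, if n ≤ j + 1 then (q (j + 1) : ℝ) else 0
  else (ν : ℝ) ^ n / (n * (2 + (ν : ℝ)) ^ n) *
    ∑' j : ℕ, (q (j + 1) : ℝ) * ((1 + 2 / (ν : ℝ)) ^ min (j + 1) n - 1)

/-- `Y_n` converges in distribution, to a law on `ℕ` whose generating function is `fY`. -/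
def HasLimitPGF (P : Measure Ω) [IsProbabilityMeasure P] (ξ : ℕ → ℕ → Ω → ℕ) (ε : ℕ → Ω → ℕ)
    (fY : ℝ → ℝ) : Prop :=
  ∃ (μ : Measure ℕ) (_ : IsProbabilityMeasure μ),
    TendstoInDistribution (process ξ ε) atTop (id : ℕ → ℕ) (fun _ => P) μ ∧
    ∀ s ∈ Set.Icc (0 : ℝ) 1, ∫ k, s ^ k ∂μ = fY s

/-- The limits `q_j`, `j ≥ 1`, exist, the series that define the `A_n` converge (their brackets are
bounded in `j`, so that this is the convergence of `∑ q_j`), and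
`fY(s) = exp (∑_{n ≥ 1} A_n (s^n - 1))` for `s ∈ [0, 1]`, with a convergent series. -/
def HasCompoundPoissonForm (P : Measure Ω) (ξ : ℕ → ℕ → Ω → ℕ) (ε : ℕ → Ω → ℕ) (ν : ℝ≥0)
    (fY : ℝ → ℝ) : Prop :=
  ∃ q : ℕ → ℝ≥0,
    (∀ j, 1 ≤ j →
      Tendsto (fun n => P {ω | ε n ω = j} / meanDefect P ξ n) atTop (𝓝 (q j : ℝ≥0∞))) ∧
    Summable (fun j => (q (j + 1) : ℝ)) ∧
    ∀ s ∈ Set.Icc (0 : ℝ) 1,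
      Summable (fun n => coeffA ν q (n + 1) * (s ^ (n + 1) - 1)) ∧
      fY s = Real.exp (∑' n, coeffA ν q (n + 1) * (s ^ (n + 1) - 1))

end NearlyCritical

end

/-! Write x = 1 - s, d_n = 1 - E ξ_n, a_n(x) = 1 - f_n(1 - x), g_n(x) = E (1 - x)^{ε_n} and F_n(x) =
E (1 - x)^{Y_n}. Independence of the generations gives F_{n+1}(x) = F_n(a_n(x)) g_n(x)
(`Model.pgf_process_succ`). Moment expansions at s = 1 give, uniformly on [0, 1] up to o(d_n x),
a_n(x) = x - d_n x (1 + νx/2) and 1 - g_n(x) = d_n x A(x), where A(x) = ∑ (-1)^k λ_{k+1} x^k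
(`alternatingSeries`).

A function G = exp(-Φ) is invariant under this recursion to first order in d_n exactly when x (1 +
νx/2) Φ'(x) = x A(x). Hence Φ(x) = ∫_0^x A(u) / (1 + νu/2) du (`limitExponent`), and G(x) -
G(a_n(x)) g_n(x) = o(d_n x) (`eventually_abs_exp_sub_le`). Since a_n(x) ≤ (1 - d_n) x, a discrepancy
proportional to x shrinks by the factor 1 - d_n in each generation. This absorbs the new errors
o(d_n x), and since ∑ d_n = ∞ it erases the initial discrepancy, so F_n → G
(`tendsto_of_contracting_recursion`). The continuity theorem for generating functions turns this
into convergence in distribution. Integrating the series of A termwise yields the logarithmic form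
of Φ, because each bracket in it is an integral Taylor remainder of log (`logTerm_eq_integral`).

For the compound Poisson form, the same expansion of g_n shows that ∑_{j ≥ 1} P(ε_n = j) s^j / d_n
tends to A(1) - (1 - s) A(1 - s). So the q_j exist and this limit is their generating function
(`ImmigrationMoments.exists_limits`). Summation by parts makes A(1 - s) the generating function of
the tails ∑_{j > i} q_j. The other factor 1 / (1 + ν(1 - s)/2) is the geometric series (1 - r) / (1
- r s) with r = ν / (2 + ν). Integrating their Cauchy product from s to 1 produces the A_n
(`hasSum_coeffA`). -/

namespace NearlyCritical

/-! ### Independence of the generations and the recursion for E s^{Y_n} -/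

variable {Ω : Type*}

/-- The generation in which a variable of the model is used. -/
def generation : (ℕ × ℕ) ⊕ ℕ → ℕ := Sum.elim Prod.fst id

/-- The σ-algebra generated by one variable of the model. -/
@[reducible]
def sigmaOf (ξ : ℕ → ℕ → Ω → ℕ) (ε : ℕ → Ω → ℕ) (i : (ℕ × ℕ) ⊕ ℕ) : MeasurableSpace Ω :=
  MeasurableSpace.comap ((Sum.elim (fun p : ℕ × ℕ => ξ p.1 p.2) ε : (ℕ × ℕ) ⊕ ℕ → Ω → ℕ) i) ⊤

/-- The σ-algebra generated by the variables of a set of generations. -/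
@[reducible]
def sigmaGen (ξ : ℕ → ℕ → Ω → ℕ) (ε : ℕ → Ω → ℕ) (S : Set ℕ) : MeasurableSpace Ω :=
  ⨆ i ∈ generation ⁻¹' S, sigmaOf ξ ε i

lemma measurable_sigmaGen_offspring (ξ : ℕ → ℕ → Ω → ℕ) (ε : ℕ → Ω → ℕ) {S : Set ℕ} {n : ℕ}
    (hn : n ∈ S) (j : ℕ) : Measurable[sigmaGen ξ ε S] (ξ n j) := by
  have h : sigmaOf ξ ε (Sum.inl (n, j)) ≤ sigmaGen ξ ε S :=
    le_iSup₂_of_le (Sum.inl (n, j)) hn le_rfl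
  exact Measurable.of_comap_le h

lemma measurable_sigmaGen_immigration (ξ : ℕ → ℕ → Ω → ℕ) (ε : ℕ → Ω → ℕ) {S : Set ℕ} {n : ℕ}
    (hn : n ∈ S) : Measurable[sigmaGen ξ ε S] (ε n) := by
  have h : sigmaOf ξ ε (Sum.inr n) ≤ sigmaGen ξ ε S :=
    le_iSup₂_of_le (Sum.inr n) hn le_rfl
  exact Measurable.of_comap_le h

lemma measurable_sigmaGen_process (ξ : ℕ → ℕ → Ω → ℕ) (ε : ℕ → Ω → ℕ) (n : ℕ) :
    Measurable[sigmaGen ξ ε (Set.Iio n)] (process ξ ε n) := by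
  -- The set S is left free because passing from n to n + 1 enlarges the σ-algebra in which the
  -- induction hypothesis is needed.
  have aux : ∀ (n : ℕ) (S : Set ℕ), Set.Iio n ⊆ S →
      Measurable[sigmaGen ξ ε S] (process ξ ε n) := by
    intro n
    induction n with
    | zero => intro S _; exact measurable_const
    | succ n ih =>
      intro S hS
      have h1 := ih S fun i hi => hS (lt_trans hi (Nat.lt_succ_self n))
      have hn : n ∈ S := hS (Nat.lt_succ_self n)
      let _ : MeasurableSpace Ω := sigmaGen ξ ε S
      have h2 : Measurable (fun p : ℕ × Ω => ∑ j ∈ Finset.range p.1, ξ n j p.2) :=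
        measurable_from_prod_countable_right fun k =>
          Finset.measurable_sum (Finset.range k) fun j _ => measurable_sigmaGen_offspring ξ ε hn j
      exact (h2.comp (h1.prodMk measurable_id)).add (measurable_sigmaGen_immigration ξ ε hn)
  exact aux n _ subset_rfl

lemma measurable_sigmaGen_pow (ξ : ℕ → ℕ → Ω → ℕ) (ε : ℕ → Ω → ℕ) (s : ℝ≥0∞) (n k : ℕ) :
    Measurable[sigmaGen ξ ε {n}] fun ω => s ^ ((∑ j ∈ Finset.range k, ξ n j ω) + ε n ω) := by
  let _ : MeasurableSpace Ω := sigmaGen ξ ε {n}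
  have h1 : Measurable fun ω => ∑ j ∈ Finset.range k, ξ n j ω :=
    Finset.measurable_sum _ fun j _ => measurable_sigmaGen_offspring ξ ε (Set.mem_singleton n) j
  have h2 : Measurable (ε n) := measurable_sigmaGen_immigration ξ ε (Set.mem_singleton n)
  have hpow : Measurable fun m : ℕ => s ^ m := measurable_of_countable _
  exact hpow.comp (h1.add h2)

variable [MeasurableSpace Ω] {P : Measure Ω} {ξ : ℕ → ℕ → Ω → ℕ} {ε : ℕ → Ω → ℕ}

lemma Model.sigmaOf_le (h : Model P ξ ε) (i : (ℕ × ℕ) ⊕ ℕ) : sigmaOf ξ ε i ≤ ‹MeasurableSpace Ω› := by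
  cases i with
  | inl p => exact (h.measurable_offspring p.1 p.2).comap_le
  | inr n => exact (h.measurable_immigration n).comap_le

lemma Model.sigmaGen_le (h : Model P ξ ε) (S : Set ℕ) : sigmaGen ξ ε S ≤ ‹MeasurableSpace Ω› :=
  iSup₂_le fun i _ => h.sigmaOf_le i

lemma Model.indep_sigmaGen (h : Model P ξ ε) {S T : Set ℕ} (hST : Disjoint S T) :
    Indep (sigmaGen ξ ε S) (sigmaGen ξ ε T) P :=
  indep_iSup_of_disjoint h.sigmaOf_le h.indep (hST.preimage generation)

lemma Model.measurable_process (h : Model P ξ ε) (n : ℕ) : Measurable (process ξ ε n) :=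
  (measurable_sigmaGen_process ξ ε n).mono (h.sigmaGen_le _) le_rfl

lemma Model.lintegral_offspring_immigration (h : Model P ξ ε) (s : ℝ≥0∞) (n k : ℕ) :
    ∫⁻ ω, s ^ ((∑ j ∈ Finset.range k, ξ n j ω) + ε n ω) ∂P =
      (∫⁻ ω, s ^ ξ n 0 ω ∂P) ^ k * ∫⁻ ω, s ^ ε n ω ∂P := by
  have hpow : Measurable fun m : ℕ => s ^ m := measurable_of_countable _
  have h1 : iIndepFun (fun i ω => s ^
      (Sum.elim (fun p : ℕ × ℕ => ξ p.1 p.2) ε : (ℕ × ℕ) ⊕ ℕ → Ω → ℕ) i ω) P :=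
    h.indep.comp (fun _ m => s ^ m) fun _ => hpow
  have hm : ∀ i, Measurable fun ω => s ^
      (Sum.elim (fun p : ℕ × ℕ => ξ p.1 p.2) ε : (ℕ × ℕ) ⊕ ℕ → Ω → ℕ) i ω := by
    rintro (p | m)
    · exact hpow.comp (h.measurable_offspring p.1 p.2)
    · exact hpow.comp (h.measurable_immigration m)
  have h2 := lintegral_prod_eq_prod_lintegral_of_indepFun
    (insert (Sum.inr n) ((Finset.range k).image fun j => (Sum.inl (n, j) : (ℕ × ℕ) ⊕ ℕ))) _ h1 hm
  have hinj : ∀ f : (ℕ × ℕ) ⊕ ℕ → ℝ≥0∞,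
      ∏ i ∈ insert (Sum.inr n) ((Finset.range k).image fun j => (Sum.inl (n, j) : (ℕ × ℕ) ⊕ ℕ)), f i
        = f (Sum.inr n) * ∏ j ∈ Finset.range k, f (Sum.inl (n, j)) := by
    intro f
    rw [Finset.prod_insert (by simp), Finset.prod_image (by intro a _ b _ hab; simpa using hab)]
  simp only [hinj, Sum.elim_inl, Sum.elim_inr] at h2
  have h3 : ∀ j, ∫⁻ ω, s ^ ξ n j ω ∂P = ∫⁻ ω, s ^ ξ n 0 ω ∂P := fun j =>
    ((h.identDistrib n j).comp hpow).lintegral_eq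
  simp only [h3, Finset.prod_const, Finset.card_range] at h2
  rw [mul_comm, ← h2]
  refine lintegral_congr fun ω => ?_
  rw [pow_add, Finset.prod_pow_eq_pow_sum, mul_comm]

lemma lintegral_eq_tsum_indicator {Y : Ω → ℕ} (hY : Measurable Y) {F : ℕ → Ω → ℝ≥0∞}
    (hF : ∀ k, Measurable (F k)) :
    ∫⁻ ω, F (Y ω) ω ∂P = ∑' k, ∫⁻ ω, (Y ⁻¹' {k}).indicator 1 ω * F k ω ∂P := by
  have hm : ∀ k, AEMeasurable (fun ω => (Y ⁻¹' {k}).indicator 1 ω * F k ω) P := fun k =>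
    ((measurable_one.indicator (hY (measurableSet_singleton k))).mul (hF k)).aemeasurable
  rw [← lintegral_tsum hm]
  refine lintegral_congr fun ω => ?_
  rw [tsum_eq_single (Y ω)]
  · simp
  · intro k hk
    have : ω ∉ Y ⁻¹' {k} := fun h => hk (by simpa using h.symm)
    simp [this]

/-- Split according to Y_n = k: this event depends on the generations before n only, so it is
independent of the k offspring variables and the immigration of generation n. Integrals in [0, ∞]
spare all integrability questions. -/
lemma Model.lintegral_process_succ (h : Model P ξ ε) (s : ℝ≥0∞) (n : ℕ) :
    ∫⁻ ω, s ^ process ξ ε (n + 1) ω ∂P =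
      (∫⁻ ω, (∫⁻ ω, s ^ ξ n 0 ω ∂P) ^ process ξ ε n ω ∂P) * ∫⁻ ω, s ^ ε n ω ∂P := by
  have hY := h.measurable_process n
  have hF := measurable_sigmaGen_pow ξ ε s n
  have hd : Disjoint (Set.Iio n) {n} := by simp
  have h1 : ∀ k, ∫⁻ ω, (process ξ ε n ⁻¹' {k}).indicator 1 ω *
      s ^ ((∑ j ∈ Finset.range k, ξ n j ω) + ε n ω) ∂P =
      (∫⁻ ω, (process ξ ε n ⁻¹' {k}).indicator 1 ω * (∫⁻ ω, s ^ ξ n 0 ω ∂P) ^ k ∂P) *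
        ∫⁻ ω, s ^ ε n ω ∂P := by
    intro k
    have hI : Measurable[sigmaGen ξ ε (Set.Iio n)]
        ((process ξ ε n ⁻¹' {k}).indicator (1 : Ω → ℝ≥0∞)) :=
      (@measurable_const ℝ≥0∞ Ω _ (sigmaGen ξ ε (Set.Iio n)) 1).indicator
        (measurable_sigmaGen_process ξ ε n (measurableSet_singleton k))
    rw [lintegral_mul_eq_lintegral_mul_lintegral_of_independent_measurableSpace
      (h.sigmaGen_le _) (h.sigmaGen_le _) (h.indep_sigmaGen hd) hI (hF k),
      h.lintegral_offspring_immigration,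
      lintegral_mul_const _ (hI.mono (h.sigmaGen_le _) le_rfl), mul_assoc]
  rw [lintegral_eq_tsum_indicator (P := P) hY (F := fun k _ => (∫⁻ ω, s ^ ξ n 0 ω ∂P) ^ k)
    fun k => measurable_const, ← ENNReal.tsum_mul_right]
  simp_rw [← h1]
  exact lintegral_eq_tsum_indicator hY fun k => (hF k).mono (h.sigmaGen_le _) le_rfl

end NearlyCritical

/-! ### Expansion of generating functions at s = 1 -/

namespace NearlyCritical

/-- Bonferroni-type bound: the error of the truncated binomial expansion is at most the first
omitted term. By Pascal's rule the error for (j + 1, K + 1) is the error for (j, K + 1) minus h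
times the error for (j, K). -/
lemma abs_one_sub_pow_sub_sum_le {h : ℝ} (h0 : 0 ≤ h) (h1 : h ≤ 1) (K j : ℕ) :
    |(1 - h) ^ j - ∑ k ∈ Finset.range K, (-h) ^ k * (j.choose k : ℝ)| ≤ j.choose K * h ^ K := by
  induction j generalizing K with
  | zero =>
    cases K with
    | zero => simp
    | succ K => simp [Finset.sum_range_succ']
  | succ j ih =>
    cases K with
    | zero =>
      simp only [Finset.range_zero, Finset.sum_empty, sub_zero, Nat.choose_zero_right, pow_zero]
      rw [abs_of_nonneg (pow_nonneg (by linarith) _)]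
      simpa using pow_le_one₀ (n := j + 1) (by linarith : 0 ≤ 1 - h) (by linarith)
    | succ K =>
      have e : (1 - h) ^ (j + 1) -
          ∑ k ∈ Finset.range (K + 1), (-h) ^ k * ((j + 1).choose k : ℝ) =
          ((1 - h) ^ j - ∑ k ∈ Finset.range (K + 1), (-h) ^ k * (j.choose k : ℝ)) +
          (-h) * ((1 - h) ^ j - ∑ k ∈ Finset.range K, (-h) ^ k * (j.choose k : ℝ)) := by
        have e1 : ∑ k ∈ Finset.range (K + 1), (-h) ^ k * ((j + 1).choose k : ℝ) =
            ∑ k ∈ Finset.range (K + 1), (-h) ^ k * (j.choose k : ℝ) +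
            (-h) * ∑ k ∈ Finset.range K, (-h) ^ k * (j.choose k : ℝ) := by
          rw [Finset.sum_range_succ', Finset.sum_range_succ' (fun k => (-h) ^ k * (j.choose k : ℝ)),
            Finset.mul_sum]
          simp only [Nat.choose_succ_succ, Nat.cast_add, Nat.choose_zero_right]
          rw [add_right_comm, ← Finset.sum_add_distrib]
          congr 1
          exact Finset.sum_congr rfl fun k _ => by ring
        rw [e1]; ring
      rw [e]
      calc _ ≤ _ := abs_add_le _ _
        _ ≤ j.choose (K + 1) * h ^ (K + 1) + h * (j.choose K * h ^ K) := by
          refine add_le_add (ih _) ?_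
          rw [abs_mul, abs_neg, abs_of_nonneg h0]
          exact mul_le_mul_of_nonneg_left (ih _) h0
        _ = _ := by rw [Nat.choose_succ_succ]; push_cast; ring

variable {Ω : Type*} [MeasurableSpace Ω] {P : Measure Ω}

/-- The probability generating function of `X`. -/
noncomputable def pgf (P : Measure Ω) (X : Ω → ℕ) (s : ℝ) : ℝ := ∫ ω, s ^ X ω ∂P

/-- The `k`-th binomial moment of `X`. -/
noncomputable def binomialMoment (P : Measure Ω) (X : Ω → ℕ) (k : ℕ) : ℝ :=
  (factorialMoment P X k).toReal / k.factorial

lemma binomialMoment_nonneg (P : Measure Ω) (X : Ω → ℕ) (k : ℕ) : 0 ≤ binomialMoment P X k := by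
  unfold binomialMoment; positivity

lemma pgf_nonneg (P : Measure Ω) (X : Ω → ℕ) {s : ℝ} (hs : 0 ≤ s) : 0 ≤ pgf P X s :=
  integral_nonneg fun _ => pow_nonneg hs _

lemma integrable_pow {X : Ω → ℕ} [IsProbabilityMeasure P] (hX : Measurable X) {s : ℝ}
    (hs : s ∈ Set.Icc (0 : ℝ) 1) : Integrable (fun ω => s ^ X ω) P := by
  refine Integrable.of_bound ((measurable_of_countable fun m : ℕ => s ^ m).comp
    hX).aestronglyMeasurable 1 (ae_of_all _ fun ω => ?_)
  rw [Real.norm_of_nonneg (pow_nonneg hs.1 _)]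
  exact pow_le_one₀ hs.1 hs.2

lemma ofReal_pgf [IsProbabilityMeasure P] {X : Ω → ℕ} (hX : Measurable X) {s : ℝ}
    (hs : s ∈ Set.Icc (0 : ℝ) 1) :
    ENNReal.ofReal (pgf P X s) = ∫⁻ ω, ENNReal.ofReal s ^ X ω ∂P := by
  rw [pgf, ofReal_integral_eq_lintegral_ofReal (integrable_pow hX hs)
    (ae_of_all _ fun ω => pow_nonneg hs.1 _)]
  exact lintegral_congr fun ω => ENNReal.ofReal_pow hs.1 _

lemma pgf_le_one [IsProbabilityMeasure P] {X : Ω → ℕ} (hX : Measurable X) {s : ℝ}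
    (hs : s ∈ Set.Icc (0 : ℝ) 1) : pgf P X s ≤ 1 := by
  have := integral_mono (integrable_pow hX hs) (integrable_const (μ := P) (1 : ℝ))
    fun ω => pow_le_one₀ hs.1 hs.2
  simpa [pgf] using this

lemma pgf_mem_Icc [IsProbabilityMeasure P] {X : Ω → ℕ} (hX : Measurable X) {s : ℝ}
    (hs : s ∈ Set.Icc (0 : ℝ) 1) : pgf P X s ∈ Set.Icc (0 : ℝ) 1 :=
  ⟨pgf_nonneg P X hs.1, pgf_le_one hX hs⟩

lemma pgf_one [IsProbabilityMeasure P] (X : Ω → ℕ) : pgf P X 1 = 1 := by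
  simp [pgf]

lemma continuousOn_pgf [IsProbabilityMeasure P] {X : Ω → ℕ} (hX : Measurable X) :
    ContinuousOn (pgf P X) (Set.Icc 0 1) := by
  refine continuousOn_of_dominated (bound := fun _ => 1)
    (fun s hs => (integrable_pow hX hs).aestronglyMeasurable)
    (fun s hs => ae_of_all _ fun ω => ?_) (integrable_const _)
    (ae_of_all _ fun ω => (continuous_pow _).continuousOn)
  rw [Real.norm_of_nonneg (pow_nonneg hs.1 _)]
  exact pow_le_one₀ hs.1 hs.2

lemma Model.pgf_process_succ [IsProbabilityMeasure P] {ξ : ℕ → ℕ → Ω → ℕ} {ε : ℕ → Ω → ℕ}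
    (h : Model P ξ ε) (n : ℕ) {s : ℝ} (hs : s ∈ Set.Icc (0 : ℝ) 1) :
    pgf P (process ξ ε (n + 1)) s =
      pgf P (process ξ ε n) (pgf P (ξ n 0) s) * pgf P (ε n) s := by
  have hf := pgf_mem_Icc (P := P) (h.measurable_offspring n 0) hs
  rw [← ENNReal.ofReal_eq_ofReal_iff (pgf_nonneg _ _ hs.1)
    (mul_nonneg (pgf_nonneg _ _ hf.1) (pgf_nonneg _ _ hs.1)),
    ENNReal.ofReal_mul (pgf_nonneg _ _ hf.1), ofReal_pgf (h.measurable_process _) hs,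
    ofReal_pgf (h.measurable_process _) hf, ofReal_pgf (h.measurable_immigration _) hs,
    ofReal_pgf (h.measurable_offspring _ _) hs, h.lintegral_process_succ]

lemma hasSum_pgf [IsProbabilityMeasure P] {X : Ω → ℕ} (hX : Measurable X) {s : ℝ}
    (hs : s ∈ Set.Icc (0 : ℝ) 1) :
    HasSum (fun k => P.real {ω | X ω = k} * s ^ k) (pgf P X s) := by
  have hint := integrable_pow (P := P) hX hs
  have hpow : AEStronglyMeasurable (fun k : ℕ => s ^ k) (P.map X) :=
    (measurable_of_countable _).aestronglyMeasurable
  have hint' : Integrable (fun k : ℕ => s ^ k) (P.map X) :=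
    (integrable_map_measure hpow hX.aemeasurable).2 hint
  have e : pgf P X s = ∫ k, s ^ k ∂(P.map X) := (integral_map hX.aemeasurable hpow).symm
  rw [e]
  have h2 := hasSum_integral_iUnion (μ := P.map X) (f := fun k : ℕ => s ^ k)
    (s := fun k : ℕ => ({k} : Set ℕ)) (fun k => measurableSet_singleton k)
    (fun i j hij => by simpa using hij) hint'.integrableOn
  rw [Set.iUnion_of_singleton, setIntegral_univ] at h2
  have h3 : ∀ k : ℕ, ∫ x in {k}, s ^ x ∂(P.map X) = P.real {ω | X ω = k} * s ^ k := fun k => by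
    rw [integral_singleton, smul_eq_mul, map_measureReal_apply hX (measurableSet_singleton k)]
    rfl
  simpa only [h3] using h2

lemma integrable_choose {X : Ω → ℕ} (hX : Measurable X) {k : ℕ}
    (hk : factorialMoment P X k ≠ ∞) :
    Integrable (fun ω => ((X ω).choose k : ℝ)) P ∧
      ∫ ω, ((X ω).choose k : ℝ) ∂P = binomialMoment P X k := by
  have hm : Measurable fun ω => (((X ω).descFactorial k : ℝ≥0∞)) :=
    (measurable_of_countable fun m : ℕ => (m.descFactorial k : ℝ≥0∞)).comp hX
  have hi : Integrable (fun ω => ((X ω).descFactorial k : ℝ)) P := by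
    simpa using integrable_toReal_of_lintegral_ne_top hm.aemeasurable hk
  have he : ∀ ω, ((X ω).choose k : ℝ) = ((X ω).descFactorial k : ℝ) / k.factorial := fun ω => by
    rw [Nat.descFactorial_eq_factorial_mul_choose]
    push_cast
    rw [mul_div_cancel_left₀ _ (by positivity)]
  have hs : ∫ ω, ((X ω).descFactorial k : ℝ) ∂P = (factorialMoment P X k).toReal := by
    have := integral_toReal hm.aemeasurable (ae_of_all P fun ω => ENNReal.natCast_lt_top _)
    simpa [factorialMoment] using this
  simp only [he]
  exact ⟨hi.div_const _, by rw [integral_div, hs, binomialMoment]⟩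

/-- The pointwise binomial bound is integrated, so finiteness of the first K moments suffices and no
derivative of the generating function has to be taken. -/
lemma abs_pgf_sub_sum_le [IsProbabilityMeasure P] {X : Ω → ℕ} (hX : Measurable X) {K : ℕ}
    (hK : ∀ k, 1 ≤ k → k ≤ K → factorialMoment P X k ≠ ∞) {h : ℝ} (hh : h ∈ Set.Icc (0 : ℝ) 1) :
    |pgf P X (1 - h) - ∑ k ∈ Finset.range K, (-h) ^ k * binomialMoment P X k| ≤
      binomialMoment P X K * h ^ K := by
  have hK' : ∀ k ≤ K, factorialMoment P X k ≠ ∞ := by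
    intro k hk
    rcases Nat.eq_zero_or_pos k with rfl | h1
    · simp [factorialMoment]
    · exact hK k h1 hk
  have hs : 1 - h ∈ Set.Icc (0 : ℝ) 1 := ⟨by linarith [hh.2], by linarith [hh.1]⟩
  have hi : ∀ k ∈ Finset.range K,
      Integrable (fun ω => (-h) ^ k * ((X ω).choose k : ℝ)) P := fun k hk =>
    (integrable_choose hX (hK' k (Finset.mem_range.1 hk).le)).1.const_mul _
  have e : pgf P X (1 - h) - ∑ k ∈ Finset.range K, (-h) ^ k * binomialMoment P X k =
      ∫ ω, ((1 - h) ^ X ω - ∑ k ∈ Finset.range K, (-h) ^ k * ((X ω).choose k : ℝ)) ∂P := by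
    rw [integral_sub (integrable_pow hX hs) (integrable_finsetSum _ hi),
      integral_finsetSum _ hi, pgf]
    congr 1
    refine Finset.sum_congr rfl fun k hk => ?_
    rw [integral_const_mul, (integrable_choose hX (hK' k (Finset.mem_range.1 hk).le)).2]
  rw [e, ← (integrable_choose hX (hK' K le_rfl)).2, ← integral_mul_const]
  refine (abs_integral_le_integral_abs).trans (integral_mono_of_nonneg
    (ae_of_all _ fun _ => abs_nonneg _) ((integrable_choose hX (hK' K le_rfl)).1.mul_const _)
    (ae_of_all _ fun ω => abs_one_sub_pow_sub_sum_le hh.1 hh.2 K (X ω)))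

lemma binomialMoment_zero [IsProbabilityMeasure P] (X : Ω → ℕ) : binomialMoment P X 0 = 1 := by
  simp [binomialMoment, factorialMoment]

/-- Applied to the offspring laws this is the contraction a_n(x) ≤ (1 - d_n) x, valid for every n
and with no error term. -/
lemma one_sub_pgf_le [IsProbabilityMeasure P] {X : Ω → ℕ} (hX : Measurable X)
    (h1 : factorialMoment P X 1 ≠ ∞) {h : ℝ} (hh : h ∈ Set.Icc (0 : ℝ) 1) :
    1 - pgf P X (1 - h) ≤ binomialMoment P X 1 * h := by
  have := abs_pgf_sub_sum_le hX (K := 1) (fun k hk hk' => le_antisymm hk' hk ▸ h1) hh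
  simp only [Finset.range_one, Finset.sum_singleton, pow_zero, one_mul, binomialMoment_zero,
    pow_one] at this
  linarith [neg_abs_le (pgf P X (1 - h) - 1)]

end NearlyCritical

/-! ### First-order asymptotics of the offspring and immigration laws -/

namespace NearlyCritical

variable {Ω : Type*} [MeasurableSpace Ω] {P : Measure Ω}
  {ξ : ℕ → ℕ → Ω → ℕ} {ε : ℕ → Ω → ℕ} {ν : ℝ≥0}

lemma NearlyCriticalOffspring.meanDefect_pos (h : NearlyCriticalOffspring P ξ ν) (n : ℕ) :
    meanDefect P ξ n ≠ 0 := (tsub_pos_of_lt (h.mean_lt_one n)).ne'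

lemma meanDefect_ne_top (P : Measure Ω) (ξ : ℕ → ℕ → Ω → ℕ) (n : ℕ) : meanDefect P ξ n ≠ ∞ :=
  (tsub_le_self.trans_lt ENNReal.one_lt_top).ne

lemma NearlyCriticalOffspring.defect_pos (h : NearlyCriticalOffspring P ξ ν) (n : ℕ) :
    0 < (meanDefect P ξ n).toReal :=
  ENNReal.toReal_pos (h.meanDefect_pos n) (meanDefect_ne_top P ξ n)

lemma defect_le_one (P : Measure Ω) (ξ : ℕ → ℕ → Ω → ℕ) (n : ℕ) :
    (meanDefect P ξ n).toReal ≤ 1 := by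
  simpa [meanDefect] using
    ENNReal.toReal_mono ENNReal.one_ne_top (tsub_le_self : meanDefect P ξ n ≤ 1)

lemma NearlyCriticalOffspring.mean_eq (h : NearlyCriticalOffspring P ξ ν) (n : ℕ) :
    binomialMoment P (ξ n 0) 1 = 1 - (meanDefect P ξ n).toReal := by
  rw [binomialMoment, meanDefect,
    ENNReal.toReal_sub_of_le (h.mean_lt_one n).le ENNReal.one_ne_top]
  simp

lemma NearlyCriticalOffspring.tendsto_defect (h : NearlyCriticalOffspring P ξ ν) :
    Tendsto (fun n => (meanDefect P ξ n).toReal) atTop (𝓝 0) := by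
  have h1 := ENNReal.Tendsto.sub (tendsto_const_nhds (x := (1 : ℝ≥0∞))) h.mean_tendsto
    (Or.inl ENNReal.one_ne_top)
  rw [tsub_self] at h1
  simpa [meanDefect, Function.comp_def] using (ENNReal.tendsto_toReal ENNReal.zero_ne_top).comp h1

lemma NearlyCriticalOffspring.not_summable_defect (h : NearlyCriticalOffspring P ξ ν) :
    ¬ Summable fun n => (meanDefect P ξ n).toReal := by
  intro hs
  have h1 := hs.tsum_ofReal_lt_top
  simp only [ENNReal.ofReal_toReal (meanDefect_ne_top P ξ _)] at h1
  exact h1.ne h.defect_sum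

/-- The binomial moments of `X n`, in units of the defect of the offspring mean, converge. -/
lemma tendsto_binomialMoment_div {X : ℕ → Ω → ℕ} {d : ℕ → ℝ≥0∞} (hd : ∀ n, d n ≠ ∞) {k : ℕ}
    {l : ℝ≥0}
    (h : Tendsto (fun n => factorialMoment P (X n) k / d n) atTop (𝓝 (l : ℝ≥0∞))) :
    (∀ᶠ n in atTop, factorialMoment P (X n) k ≠ ∞) ∧
    Tendsto (fun n => binomialMoment P (X n) k / (d n).toReal) atTop (𝓝 (l / k.factorial)) := by
  constructor
  · have h1 : ∀ᶠ n in atTop, factorialMoment P (X n) k / d n < ∞ :=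
      h.eventually_lt_const ENNReal.coe_lt_top
    filter_upwards [h1] with n hn hn'
    rw [hn', ENNReal.top_div_of_ne_top (hd n)] at hn
    exact lt_irrefl _ hn
  · have h1 := ((ENNReal.tendsto_toReal ENNReal.coe_ne_top).comp h).div_const (k.factorial : ℝ)
    refine h1.congr fun n => ?_
    simp only [Function.comp_apply, ENNReal.toReal_div, binomialMoment]
    ring

lemma ImmigrationLimit.eventually_ne_top {k : ℕ} {l : ℝ≥0} (h : ImmigrationLimit P ξ ε k l) :
    ∀ᶠ n in atTop, factorialMoment P (ε n) k ≠ ∞ :=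
  (tendsto_binomialMoment_div (d := fun n => (k.factorial : ℝ≥0∞) * meanDefect P ξ n)
    (fun n => ENNReal.mul_ne_top (ENNReal.natCast_ne_top _) (meanDefect_ne_top P ξ n)) h).1

lemma ImmigrationLimit.tendsto_div {k : ℕ} {l : ℝ≥0} (h : ImmigrationLimit P ξ ε k l) :
    Tendsto (fun n => binomialMoment P (ε n) k / (meanDefect P ξ n).toReal) atTop (𝓝 (l : ℝ)) := by
  have h1 := ((tendsto_binomialMoment_div (d := fun n => (k.factorial : ℝ≥0∞) * meanDefect P ξ n)
    (fun n => ENNReal.mul_ne_top (ENNReal.natCast_ne_top _) (meanDefect_ne_top P ξ n)) h).2).mul_const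
      (k.factorial : ℝ)
  have hk : (k.factorial : ℝ) ≠ 0 := by positivity
  rw [div_mul_cancel₀ _ hk] at h1
  refine h1.congr fun n => ?_
  rw [ENNReal.toReal_mul, ENNReal.toReal_natCast]
  field_simp

variable [IsProbabilityMeasure P]

lemma NearlyCriticalOffspring.eventually_abs_one_sub_pgf_sub_le (h : NearlyCriticalOffspring P ξ ν)
    (hm : ∀ n j, Measurable (ξ n j)) {τ : ℝ} (hτ : 0 < τ) :
    ∀ᶠ n in atTop, ∀ x ∈ Set.Icc (0 : ℝ) 1,
      |1 - pgf P (ξ n 0) (1 - x) - x + (meanDefect P ξ n).toReal * (x * (1 + ν * x / 2))| ≤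
        τ * (meanDefect P ξ n).toReal * x := by
  have h1 : ∀ n, factorialMoment P (ξ n 0) 1 ≠ ∞ := fun n =>
    ((h.mean_lt_one n).trans ENNReal.one_lt_top).ne
  obtain ⟨f2, t2⟩ := tendsto_binomialMoment_div (fun n => meanDefect_ne_top P ξ n) h.second
  rcases eq_or_ne ν 0 with rfl | hν
  -- For ν = 0 the second moment is itself o(d_n), so the linear expansion is enough and no third
  -- moment is involved.
  · have t2' := t2.eventually_le_const (u := τ) (by simpa using hτ)
    filter_upwards [f2, t2'] with n f2 t2 x hx
    have hd := h.defect_pos n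
    have e := abs_pgf_sub_sum_le (hm n 0) (K := 2) (fun k hk hk' => by
      interval_cases k
      · exact h1 n
      · exact f2) hx
    simp only [Finset.sum_range_succ, Finset.range_zero, Finset.sum_empty, binomialMoment_zero,
      h.mean_eq] at e
    rw [div_le_iff₀ hd] at t2
    have e2 : binomialMoment P (ξ n 0) 2 * x ^ 2 ≤ τ * (meanDefect P ξ n).toReal * x :=
      mul_le_mul t2 (by nlinarith [hx.1, hx.2]) (by positivity) (by positivity)
    refine le_trans (le_of_eq ?_) (e.trans e2)
    rw [← abs_neg]
    congr 1
    simp only [NNReal.coe_zero]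
    ring
  -- For ν > 0 the quadratic term is kept. Half of τ pays for replacing the second binomial moment
  -- by (ν/2) d_n, the other half for the third-moment remainder.
  · obtain ⟨f3, t3⟩ := tendsto_binomialMoment_div (l := 0) (fun n => meanDefect_ne_top P ξ n)
      (h.third (pos_iff_ne_zero.2 hν))
    have t3' := t3.eventually_le_const (u := τ / 2) (by simpa using hτ)
    have t2' := (tendsto_iff_norm_sub_tendsto_zero.1 t2).eventually_le_const (half_pos hτ)
    filter_upwards [f2, f3, t2', t3'] with n f2 f3 t2 t3 x hx
    have hd := h.defect_pos n
    have e := abs_pgf_sub_sum_le (hm n 0) (K := 3) (fun k hk hk' => by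
      interval_cases k
      · exact h1 n
      · exact f2
      · exact f3) hx
    simp only [Finset.sum_range_succ, Finset.range_zero, Finset.sum_empty, binomialMoment_zero,
      h.mean_eq] at e
    set d := (meanDefect P ξ n).toReal
    set b := binomialMoment P (ξ n 0) 2
    have hb : b = (b / d - ν / 2) * d + ν / 2 * d := by field_simp; ring
    rw [div_le_iff₀ hd] at t3
    rw [Real.norm_eq_abs] at t2
    norm_num at t2
    have e3 : binomialMoment P (ξ n 0) 3 * x ^ 3 ≤ τ / 2 * d * x :=
      mul_le_mul t3 (by nlinarith [hx.1, hx.2, mul_nonneg hx.1 hx.1]) (by have := hx.1; positivity) (by positivity)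
    have e2 : |(b / d - ν / 2) * d * x ^ 2| ≤ τ / 2 * d * x := by
      rw [abs_mul, abs_mul, abs_of_pos hd, abs_of_nonneg (sq_nonneg x)]
      exact mul_le_mul (mul_le_mul_of_nonneg_right t2 hd.le) (by nlinarith [hx.1, hx.2])
        (by positivity) (by positivity)
    have e4 : 1 - pgf P (ξ n 0) (1 - x) - x + d * (x * (1 + ν * x / 2)) =
        -(pgf P (ξ n 0) (1 - x) - (0 + (-x) ^ 0 * 1 + (-x) ^ 1 * (1 - d) + (-x) ^ 2 * b)) -
          (b / d - ν / 2) * d * x ^ 2 := by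
      linear_combination (-x ^ 2) * hb
    rw [e4]
    refine (abs_sub _ _).trans ?_
    rw [abs_neg]
    linarith

/-- The remainder is governed by the K-th moment, of size about l_K d_n, and x^k ≤ x charges every
error to d_n x. Hence any tolerance above l_K is reached, and precision comes later from choosing K
with small l_K. -/
lemma eventually_abs_one_sub_pgf_sub_sum_le {X : ℕ → Ω → ℕ} (hX : ∀ n, Measurable (X n))
    {d : ℕ → ℝ} (hd : ∀ n, 0 < d n) {l : ℕ → ℝ} {K : ℕ} (hK : 1 ≤ K)
    (hf : ∀ k, 1 ≤ k → k ≤ K → ∀ᶠ n in atTop, factorialMoment P (X n) k ≠ ∞)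
    (hl : ∀ k, 1 ≤ k → k ≤ K →
      Tendsto (fun n => binomialMoment P (X n) k / d n) atTop (𝓝 (l k))) {τ : ℝ} (hτ : l K < τ) :
    ∀ᶠ n in atTop, ∀ x ∈ Set.Icc (0 : ℝ) 1,
      |1 - pgf P (X n) (1 - x) - d n * ∑ k ∈ Finset.Ico 1 K, (-1) ^ (k + 1) * l k * x ^ k| ≤
        τ * d n * x := by
  have hf' : ∀ᶠ n in atTop, ∀ k ∈ Finset.Icc 1 K, factorialMoment P (X n) k ≠ ∞ :=
    (Finset.eventually_all _).2 fun k hk => hf k (Finset.mem_Icc.1 hk).1 (Finset.mem_Icc.1 hk).2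
  have ht : Tendsto (fun n => ∑ k ∈ Finset.Ico 1 K, |binomialMoment P (X n) k / d n - l k| +
      binomialMoment P (X n) K / d n) atTop (𝓝 (∑ k ∈ Finset.Ico 1 K, |l k - l k| + l K)) := by
    refine (tendsto_finsetSum _ fun k hk => ?_).add (hl K hK le_rfl)
    exact ((hl k (Finset.mem_Ico.1 hk).1 (Finset.mem_Ico.1 hk).2.le).sub_const _).abs
  simp only [sub_self, abs_zero, Finset.sum_const_zero, zero_add] at ht
  filter_upwards [hf', ht.eventually_le_const hτ] with n hf ht x hx
  have e := abs_pgf_sub_sum_le (hX n) (fun k hk hk' => hf k (Finset.mem_Icc.2 ⟨hk, hk'⟩)) hx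
  have hd := hd n
  rw [Finset.range_eq_Ico, Finset.sum_eq_sum_Ico_succ_bot hK, pow_zero, binomialMoment_zero,
    one_mul, zero_add] at e
  have hx0 := hx.1
  have hpow : ∀ k, 1 ≤ k → x ^ k ≤ x := fun k hk => by
    simpa using pow_le_pow_of_le_one hx.1 hx.2 hk
  have e1 : 1 - pgf P (X n) (1 - x) - d n * ∑ k ∈ Finset.Ico 1 K, (-1) ^ (k + 1) * l k * x ^ k =
      -(pgf P (X n) (1 - x) - (1 + ∑ k ∈ Finset.Ico 1 K, (-x) ^ k * binomialMoment P (X n) k)) +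
      ∑ k ∈ Finset.Ico 1 K,
        (-1) ^ (k + 1) * (binomialMoment P (X n) k / d n - l k) * (d n * x ^ k) := by
    have : ∀ k, (-1) ^ (k + 1) * (binomialMoment P (X n) k / d n - l k) * (d n * x ^ k) =
        -((-x) ^ k * binomialMoment P (X n) k) - d n * ((-1) ^ (k + 1) * l k * x ^ k) := fun k => by
      rw [neg_pow x]; field_simp; ring
    simp only [this, Finset.sum_sub_distrib, Finset.sum_neg_distrib, Finset.mul_sum]
    ring
  have e2 : |∑ k ∈ Finset.Ico 1 K,
        (-1) ^ (k + 1) * (binomialMoment P (X n) k / d n - l k) * (d n * x ^ k)| ≤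
      (∑ k ∈ Finset.Ico 1 K, |binomialMoment P (X n) k / d n - l k|) * (d n * x) := by
    rw [Finset.sum_mul]
    refine (Finset.abs_sum_le_sum_abs _ _).trans (Finset.sum_le_sum fun k hk => ?_)
    rw [abs_mul, abs_mul, abs_pow, abs_neg, abs_one, one_pow, one_mul,
      abs_of_nonneg (by positivity : 0 ≤ d n * x ^ k)]
    have := hpow k (Finset.mem_Ico.1 hk).1
    gcongr
  have e3 : binomialMoment P (X n) K * x ^ K ≤ binomialMoment P (X n) K / d n * (d n * x) := by
    rw [← mul_assoc, div_mul_cancel₀ _ hd.ne']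
    exact mul_le_mul_of_nonneg_left (hpow K hK) (binomialMoment_nonneg _ _ _)
  rw [e1]
  refine (abs_add_le _ _).trans ?_
  rw [abs_neg]
  calc _ ≤ binomialMoment P (X n) K / d n * (d n * x) +
      (∑ k ∈ Finset.Ico 1 K, |binomialMoment P (X n) k / d n - l k|) * (d n * x) :=
        add_le_add (e.trans e3) e2
    _ = (∑ k ∈ Finset.Ico 1 K, |binomialMoment P (X n) k / d n - l k| +
          binomialMoment P (X n) K / d n) * (d n * x) := by ring
    _ ≤ τ * (d n * x) := mul_le_mul_of_nonneg_right ht (by positivity)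
    _ = _ := by ring

end NearlyCritical

/-! ### The contracting recursion and its approximate fixed point -/

namespace NearlyCritical

/-- Continuity handles x < r; for x ≥ r the global bound B is at most (B / r) x. This puts the
initial discrepancy into the affine form that the recursion preserves. -/
lemma exists_abs_le_add_mul {D : ℝ → ℝ} (hD : ContinuousOn D (Set.Icc 0 1)) (h0 : D 0 = 0)
    {τ : ℝ} (hτ : 0 < τ) : ∃ C : ℝ, 0 ≤ C ∧ ∀ x ∈ Set.Icc (0 : ℝ) 1, |D x| ≤ τ + C * x := by
  obtain ⟨B, hB⟩ := isCompact_Icc.exists_bound_of_continuousOn hD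
  have hB0 : 0 ≤ B := (norm_nonneg _).trans (hB 0 (by simp))
  obtain ⟨r, hr, hr'⟩ := Metric.continuousWithinAt_iff.1 (hD 0 (by simp)) τ hτ
  refine ⟨B / r, by positivity, fun x hx => ?_⟩
  rcases lt_or_ge x r with h | h
  · have := hr' hx (by simpa [abs_of_nonneg hx.1] using h)
    rw [h0, Real.dist_eq, sub_zero] at this
    have : 0 ≤ B / r * x := mul_nonneg (by positivity) hx.1
    linarith
  · have h1 : 1 ≤ x / r := (one_le_div hr).2 h
    have h2 : B ≤ B / r * x := by
      calc B = B * 1 := (mul_one B).symm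
        _ ≤ B * (x / r) := mul_le_mul_of_nonneg_left h1 hB0
        _ = _ := by ring
    have := hB x hx
    rw [Real.norm_eq_abs] at this
    linarith

lemma tendsto_prod_one_sub_zero {d : ℕ → ℝ} (hd0 : ∀ n, 0 ≤ d n) (hd1 : ∀ n, d n ≤ 1)
    (hd : ¬ Summable d) :
    Tendsto (fun m => ∏ i ∈ Finset.range m, (1 - d i)) atTop (𝓝 0) := by
  have h1 := (not_summable_iff_tendsto_nat_atTop_of_nonneg hd0).1 hd
  have h2 : Tendsto (fun m => Real.exp (-∑ i ∈ Finset.range m, d i)) atTop (𝓝 0) :=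
    Real.tendsto_exp_neg_atTop_nhds_zero.comp h1
  refine squeeze_zero (fun m => Finset.prod_nonneg fun i _ => sub_nonneg.2 (hd1 i)) (fun m => ?_) h2
  rw [← Finset.sum_neg_distrib, Real.exp_sum]
  exact Finset.prod_le_prod (fun i _ => sub_nonneg.2 (hd1 i)) fun i _ => Real.one_sub_le_exp_neg _

/-- A perturbed fixed point of a sequence of contracting composition operators attracts. -/
lemma tendsto_of_contracting_recursion {F a g : ℕ → ℝ → ℝ} {G : ℝ → ℝ} {d : ℕ → ℝ}
    (hd0 : ∀ n, 0 ≤ d n) (hd1 : ∀ n, d n ≤ 1) (hd : ¬ Summable d)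
    (hF : ∀ n, ∀ x ∈ Set.Icc (0 : ℝ) 1, F (n + 1) x = F n (a n x) * g n x)
    (ha : ∀ n, ∀ x ∈ Set.Icc (0 : ℝ) 1, a n x ∈ Set.Icc (0 : ℝ) 1)
    (ha' : ∀ n, ∀ x ∈ Set.Icc (0 : ℝ) 1, a n x ≤ (1 - d n) * x)
    (hg : ∀ n, ∀ x ∈ Set.Icc (0 : ℝ) 1, |g n x| ≤ 1)
    (hFc : ∀ n, ContinuousOn (F n) (Set.Icc 0 1)) (hF0 : ∀ n, F n 0 = 1)
    (hGc : ContinuousOn G (Set.Icc 0 1)) (hG0 : G 0 = 1)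
    (hG : ∀ τ > 0, ∀ᶠ n in atTop, ∀ x ∈ Set.Icc (0 : ℝ) 1,
      |G x - G (a n x) * g n x| ≤ τ * d n * x) {x : ℝ} (hx : x ∈ Set.Icc (0 : ℝ) 1) :
    Tendsto (fun n => F n x) atTop (𝓝 (G x)) := by
  rw [Metric.tendsto_atTop']
  intro η hη
  have hτ : 0 < η / 4 := by positivity
  obtain ⟨N, hN⟩ := eventually_atTop.1 (hG (η / 4) hτ)
  obtain ⟨C, hC0, hC⟩ := exists_abs_le_add_mul ((hFc N).sub hGc)
    (by simp [hF0, hG0]) hτ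
  -- One generation maps a slope c to (1 - d) c + (η/4) d. The value η/4 is fixed by this map, while
  -- the excess over it is multiplied by 1 - d; the constant term is preserved because |g| ≤ 1.
  have key : ∀ m, ∀ x ∈ Set.Icc (0 : ℝ) 1, |F (m + N) x - G x| ≤
      η / 4 + (C * ∏ i ∈ Finset.range m, (1 - d (i + N)) + η / 4) * x := by
    intro m
    induction m with
    | zero =>
      intro x hx
      have := hC x hx
      simp only [Finset.range_zero, Finset.prod_empty, mul_one, zero_add]
      have := mul_nonneg hτ.le hx.1
      simp only [Pi.sub_apply] at *
      linarith
    | succ m ih =>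
      intro x hx
      rw [add_right_comm, hF _ x hx, Finset.prod_range_succ]
      set p := ∏ i ∈ Finset.range m, (1 - d (i + N))
      have hp : 0 ≤ p := Finset.prod_nonneg fun i _ => sub_nonneg.2 (hd1 _)
      have e1 := ih _ (ha (m + N) x hx)
      have e2 := hN (m + N) (by omega) x hx
      have e3 := ha' (m + N) x hx
      have e4 : (C * p + η / 4) * a (m + N) x ≤ (C * p + η / 4) * ((1 - d (m + N)) * x) :=
        mul_le_mul_of_nonneg_left e3 (by positivity)
      have e5 : F (m + N) (a (m + N) x) * g (m + N) x - G x =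
          (F (m + N) (a (m + N) x) - G (a (m + N) x)) * g (m + N) x -
          (G x - G (a (m + N) x) * g (m + N) x) := by ring
      have e6 : |(F (m + N) (a (m + N) x) - G (a (m + N) x)) * g (m + N) x| ≤
          |F (m + N) (a (m + N) x) - G (a (m + N) x)| := by
        rw [abs_mul]
        exact mul_le_of_le_one_right (abs_nonneg _) (hg _ x hx)
      rw [e5]
      refine (abs_sub _ _).trans ?_
      calc _ ≤ (η / 4 + (C * p + η / 4) * ((1 - d (m + N)) * x)) + η / 4 * d (m + N) * x := by
            linarith
        _ = _ := by ring
  have hp := (tendsto_prod_one_sub_zero (fun n => hd0 (n + N)) (fun n => hd1 (n + N))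
    ((summable_nat_add_iff N).not.2 hd)).const_mul C
  rw [mul_zero] at hp
  obtain ⟨m₀, hm₀⟩ := eventually_atTop.1 (hp.eventually_le_const hτ)
  refine ⟨m₀ + N, fun n hn => ?_⟩
  obtain ⟨m, rfl⟩ : ∃ m, n = m + N := ⟨n - N, by omega⟩
  have e1 := key m x hx
  have e2 := hm₀ m (by omega)
  have e3 : (C * ∏ i ∈ Finset.range m, (1 - d (i + N)) + η / 4) * x ≤ (η / 4 + η / 4) * 1 :=
    mul_le_mul (by linarith) hx.2 hx.1 (by positivity)
  rw [Real.dist_eq]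
  linarith

/-- The increment w of ∫ Ψ from a_n(x) to x is about Ψ(x) (x - a_n(x)), hence about d_n x (1 + νx/2)
Ψ(x), which is also the first-order part of 1 - g_n(x). So exp(-w) and g_n(x) agree up to o(d_n x).
-/
lemma eventually_abs_exp_sub_le {Ψ : ℝ → ℝ} (hΨ : ContinuousOn Ψ (Set.Icc 0 1)) {ν : ℝ}
    (hν : 0 ≤ ν) {a g : ℕ → ℝ → ℝ} {d : ℕ → ℝ} (hd0 : ∀ n, 0 < d n)
    (hd : Tendsto d atTop (𝓝 0))
    (ha : ∀ n, ∀ x ∈ Set.Icc (0 : ℝ) 1, a n x ∈ Set.Icc (0 : ℝ) 1)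
    (ha' : ∀ τ > 0, ∀ᶠ n in atTop, ∀ x ∈ Set.Icc (0 : ℝ) 1,
      |a n x - x + d n * (x * (1 + ν * x / 2))| ≤ τ * d n * x)
    (hg : ∀ τ > 0, ∀ᶠ n in atTop, ∀ x ∈ Set.Icc (0 : ℝ) 1,
      |1 - g n x - d n * (x * (1 + ν * x / 2) * Ψ x)| ≤ τ * d n * x) {τ : ℝ} (hτ : 0 < τ) :
    ∀ᶠ n in atTop, ∀ x ∈ Set.Icc (0 : ℝ) 1,
      |Real.exp (-((∫ t in (0 : ℝ)..x, Ψ t) - ∫ t in (0 : ℝ)..(a n x), Ψ t)) - g n x| ≤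
        τ * d n * x := by
  obtain ⟨B, hB⟩ := isCompact_Icc.exists_bound_of_continuousOn hΨ
  have hB0 : 0 ≤ B := (norm_nonneg _).trans (hB 0 (by simp))
  set C : ℝ := 1 + ν / 2 with hC
  have hC1 : 1 ≤ C := by rw [hC]; linarith
  -- Error budget in units of σ d_n x: C + 1 for the oscillation of Ψ, B for the expansion of a_n,
  -- and one each for the remainder of exp and the expansion of g_n.
  obtain ⟨σ, hσ0, hσ1, hσ⟩ : ∃ σ : ℝ, 0 < σ ∧ σ ≤ 1 ∧ σ * (C + 1 + B + 2) ≤ τ := by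
    refine ⟨min 1 (τ / (C + 1 + B + 2)), by positivity, min_le_left _ _, ?_⟩
    rw [← le_div_iff₀ (by positivity)]
    exact min_le_right _ _
  obtain ⟨ρ, hρ, hρ'⟩ := Metric.uniformContinuousOn_iff.1
    (isCompact_Icc.uniformContinuousOn_of_continuous hΨ) σ hσ0
  have hdc : ∀ c : ℝ, Tendsto (fun n => c * d n) atTop (𝓝 0) := fun c => by
    simpa using hd.const_mul c
  -- The three smallness conditions on d_n keep the segment from a_n(x) to x within the modulus of
  -- continuity ρ, ensure |w| ≤ 1 for the estimate of exp, and absorb the term w² into σ d_n x.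
  filter_upwards [ha' σ hσ0, hg σ hσ0, (hdc (C + 1)).eventually_lt_const hρ,
    (hdc (B * (C + 1))).eventually_le_const one_pos,
    (hdc ((B * (C + 1)) ^ 2)).eventually_le_const hσ0] with n ha' hg h1 h2 h3 x hx
  have hx0 := hx.1
  have hx1 := hx.2
  have ha' := ha' x hx
  have hg := hg x hx
  have hd0 := hd0 n
  have hax := ha n x hx
  set y := a n x
  set e := d n
  set c := 1 + ν * x / 2
  have hc1 : 1 ≤ c := by simp only [c]; nlinarith [mul_nonneg hν hx0]
  have hcC : c ≤ C := by simp only [c, hC]; nlinarith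
  have hu : |x - y| ≤ (C + 1) * (e * x) := by
    have : x - y = e * (x * c) - (y - x + e * (x * c)) := by ring
    rw [this]
    refine (abs_sub _ _).trans ?_
    rw [abs_of_nonneg (by positivity)]
    have i1 : e * (x * c) ≤ e * (x * C) := by gcongr
    have i2 : σ * e * x ≤ 1 * e * x := by gcongr
    linarith
  have hsub : Set.uIcc y x ⊆ Set.Icc 0 1 := Set.uIcc_subset_Icc hax hx
  have hint : ∀ u ∈ Set.Icc (0 : ℝ) 1, ∀ v ∈ Set.Icc (0 : ℝ) 1,
      IntervalIntegrable Ψ volume u v := fun u hu v hv =>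
    (hΨ.mono (Set.uIcc_subset_Icc hu hv)).intervalIntegrable
  have h0 : (0 : ℝ) ∈ Set.Icc (0 : ℝ) 1 := by simp
  set w := (∫ t in (0 : ℝ)..x, Ψ t) - ∫ t in (0 : ℝ)..y, Ψ t with hw
  have hw' : w = ∫ t in y..x, Ψ t :=
    intervalIntegral.integral_interval_sub_left (hint 0 h0 x hx) (hint 0 h0 y hax)
  have hwB : |w| ≤ B * (C + 1) * (e * x) := by
    have : ‖∫ t in y..x, Ψ t‖ ≤ B * |x - y| :=
      intervalIntegral.norm_integral_le_of_norm_le_const fun t ht =>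
        hB t (hsub (Set.uIoc_subset_uIcc ht))
    rw [hw', mul_assoc]
    exact this.trans (mul_le_mul_of_nonneg_left hu hB0)
  have hwΨ : |w - Ψ x * (x - y)| ≤ σ * ((C + 1) * (e * x)) := by
    have e1 : w - Ψ x * (x - y) = ∫ t in y..x, (Ψ t - Ψ x) := by
      rw [intervalIntegral.integral_sub (hint y hax x hx) (by simp), ← hw']
      simp [mul_comm]
    have : ‖∫ t in y..x, (Ψ t - Ψ x)‖ ≤ σ * |x - y| := by
      refine intervalIntegral.norm_integral_le_of_norm_le_const fun t ht => ?_
      have ht := Set.uIoc_subset_uIcc ht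
      have hd : dist t x < ρ := by
        rw [dist_comm, Real.dist_eq]
        have : |x - t| ≤ |x - y| := Set.abs_sub_right_of_mem_uIcc ht
        refine (this.trans hu).trans_lt (lt_of_le_of_lt ?_ h1)
        have : e * x ≤ e := by nlinarith
        gcongr
      exact (hρ' t (hsub ht) x hx hd).le
    rw [e1]
    exact this.trans (mul_le_mul_of_nonneg_left hu hσ0.le)
  have hwd : |w - e * (x * c * Ψ x)| ≤ σ * (C + 1 + B) * (e * x) := by
    have e1 : w - e * (x * c * Ψ x) =
        (w - Ψ x * (x - y)) - Ψ x * (y - x + e * (x * c)) := by ring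
    rw [e1]
    refine (abs_sub _ _).trans ?_
    rw [abs_mul]
    have := mul_le_mul (hB x hx) ha' (abs_nonneg _) hB0
    rw [Real.norm_eq_abs] at this
    linarith
  have hw1 : |w| ≤ 1 := by
    refine hwB.trans (le_trans ?_ h2)
    have : e * x ≤ e := by nlinarith
    gcongr
  have hexp : |Real.exp (-w) - 1 - -w| ≤ σ * (e * x) := by
    refine (Real.abs_exp_sub_one_sub_id_le (by rwa [abs_neg])).trans ?_
    rw [neg_sq, ← sq_abs]
    calc |w| ^ 2 ≤ (B * (C + 1) * (e * x)) ^ 2 := by gcongr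
      _ = ((B * (C + 1)) ^ 2 * e) * x * (e * x) := by ring
      _ ≤ σ * 1 * (e * x) := by gcongr
      _ = _ := by ring
  have e2 : Real.exp (-w) - g n x = (Real.exp (-w) - 1 - -w) - (w - e * (x * c * Ψ x)) +
      (1 - g n x - e * (x * c * Ψ x)) := by ring
  rw [e2]
  refine (abs_add_le _ _).trans ((add_le_add_left (abs_sub _ _) _).trans ?_)
  have : σ * (C + 1 + B + 2) * (e * x) ≤ τ * (e * x) := by gcongr
  linarith

end NearlyCritical

/-! ### Continuity theorem for generating functions -/

namespace NearlyCritical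

lemma exists_tendsto_of_forall_approx {a : ℕ → ℝ}
    (h : ∀ τ > 0, ∃ (c : ℕ → ℝ) (l : ℝ), Tendsto c atTop (𝓝 l) ∧ ∀ᶠ n in atTop, |a n - c n| ≤ τ) :
    ∃ p, Tendsto a atTop (𝓝 p) := by
  refine cauchySeq_tendsto_of_complete (Metric.cauchySeq_iff'.2 fun η hη => ?_)
  obtain ⟨c, l, hc, hac⟩ := h (η / 5) (by positivity)
  have hc' := (tendsto_iff_norm_sub_tendsto_zero.1 hc).eventually_le_const
    (by positivity : 0 < η / 5)
  obtain ⟨N, hN⟩ := eventually_atTop.1 (hac.and hc')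
  refine ⟨N, fun n hn => ?_⟩
  obtain ⟨h1, h2⟩ := hN n hn
  obtain ⟨h3, h4⟩ := hN N le_rfl
  simp only [Real.norm_eq_abs] at h2 h4
  rw [Real.dist_eq]
  rw [abs_le] at *
  rw [abs_lt]
  constructor <;> linarith

/-- If the generating functions of nonnegative sequences of bounded mass converge on `(0, 1)`, then
the sequences converge termwise, and the limit function is the generating function of the limit. -/
lemma exists_tendsto_coeff {a : ℕ → ℕ → ℝ} (ha : ∀ n k, 0 ≤ a n k) {C : ℝ}
    (hC : ∀ᶠ n in atTop, Summable (a n) ∧ ∑' k, a n k ≤ C) {H : ℝ → ℝ}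
    (hH : ∀ s ∈ Set.Ioo (0 : ℝ) 1, Tendsto (fun n => ∑' k, a n k * s ^ k) atTop (𝓝 (H s))) :
    ∃ p : ℕ → ℝ, (∀ k, Tendsto (fun n => a n k) atTop (𝓝 (p k))) ∧ (∀ k, 0 ≤ p k) ∧
      Summable p ∧ ∑' k, p k ≤ C ∧ ∀ s ∈ Set.Ioo (0 : ℝ) 1, HasSum (fun k => p k * s ^ k) (H s) := by
  have hC0 : 0 ≤ C := by
    obtain ⟨n, h1, h2⟩ := hC.exists
    exact (tsum_nonneg (ha n)).trans h2
  have hsum : ∀ n, Summable (a n) → ∀ s ∈ Set.Ioo (0 : ℝ) 1, ∀ m : ℕ,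
      Summable fun k => a n k * s ^ (k + m) := fun n hn s hs m =>
    Summable.of_nonneg_of_le (fun k => mul_nonneg (ha n k) (pow_nonneg hs.1.le _))
      (fun k => mul_le_of_le_one_right (ha n k) (pow_le_one₀ hs.1.le hs.2.le)) hn
  have hex : ∀ k, ∃ p, Tendsto (fun n => a n k) atTop (𝓝 p) := by
    intro k
    induction k using Nat.strong_induction_on with
    | _ k ih =>
    choose! p hp using ih
    -- Removing the lower coefficients, already known to converge, and dividing by s^k leaves the
    -- k-th coefficient plus a remainder between 0 and s C; a small s makes it at most τ.
    refine exists_tendsto_of_forall_approx fun τ hτ => ?_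
    obtain ⟨s, hs, hsC⟩ : ∃ s ∈ Set.Ioo (0 : ℝ) 1, s * C ≤ τ := by
      refine ⟨min (1 / 2) (τ / (C + 1)), ⟨by positivity, by
        exact (min_le_left _ _).trans_lt (by norm_num)⟩, ?_⟩
      calc _ ≤ τ / (C + 1) * (C + 1) := by
            gcongr
            · exact min_le_right _ _
            · linarith
        _ = τ := by field_simp
    refine ⟨fun n => (∑' i, a n i * s ^ i - ∑ i ∈ Finset.range k, a n i * s ^ i) / s ^ k, _,
      ((hH s hs).sub (tendsto_finsetSum _ fun i hi =>
        (hp i (Finset.mem_range.1 hi)).mul_const (s ^ i))).div_const _, ?_⟩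
    filter_upwards [hC] with n hn
    have hs0 := hs.1
    have e1 := (hsum n hn.1 s hs 0).sum_add_tsum_nat_add (k + 1)
    simp only [add_zero] at e1
    have hshift : Summable fun i => a n (i + (k + 1)) := (summable_nat_add_iff (k + 1)).2 hn.1
    have e2 : ∑' i, a n (i + (k + 1)) * s ^ (i + (k + 1)) =
        s ^ k * ∑' i, a n (i + (k + 1)) * s ^ (i + 1) := by
      rw [← tsum_mul_left]
      exact tsum_congr fun i => by ring
    have e3 : (∑' i, a n i * s ^ i - ∑ i ∈ Finset.range k, a n i * s ^ i) / s ^ k =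
        a n k + ∑' i, a n (i + (k + 1)) * s ^ (i + 1) := by
      rw [← e1, e2, Finset.sum_range_succ, div_eq_iff (by positivity)]
      ring
    have e4 : ∑' i, a n (i + (k + 1)) * s ^ (i + 1) ≤ s * C := by
      have hle : ∀ i, a n (i + (k + 1)) * s ^ (i + 1) ≤ s * a n (i + (k + 1)) := fun i => by
        rw [mul_comm s]
        refine mul_le_mul_of_nonneg_left ?_ (ha _ _)
        simpa using pow_le_pow_of_le_one hs.1.le hs.2.le (Nat.le_add_left 1 i)
      have hn2 := hn.1.sum_add_tsum_nat_add (k + 1)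
      have hn3 : 0 ≤ ∑ i ∈ Finset.range (k + 1), a n i := Finset.sum_nonneg fun i _ => ha n i
      have hs1 : Summable fun i => a n (i + (k + 1)) * s ^ (i + 1) :=
        Summable.of_nonneg_of_le (fun i => mul_nonneg (ha _ _) (by positivity)) hle
          (hshift.mul_left s)
      calc _ ≤ ∑' i, s * a n (i + (k + 1)) := hs1.tsum_le_tsum hle (hshift.mul_left s)
        _ = s * ∑' i, a n (i + (k + 1)) := tsum_mul_left
        _ ≤ s * C := mul_le_mul_of_nonneg_left (by linarith [hn.2]) hs0.le
    have e5 : 0 ≤ ∑' i, a n (i + (k + 1)) * s ^ (i + 1) :=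
      tsum_nonneg fun i => mul_nonneg (ha _ _) (by positivity)
    rw [e3, abs_le]
    constructor <;> linarith
  choose p hp using hex
  have hp0 : ∀ k, 0 ≤ p k := fun k => ge_of_tendsto' (hp k) fun n => ha n k
  have hpC : ∀ u : Finset ℕ, ∑ k ∈ u, p k ≤ C := fun u => by
    refine le_of_tendsto (tendsto_finsetSum u fun k _ => hp k) ?_
    filter_upwards [hC] with n hn
    exact (hn.1.sum_le_tsum u fun k _ => ha n k).trans hn.2
  have hps : Summable p := summable_of_sum_le hp0 hpC
  refine ⟨p, hp, hp0, hps, hps.tsum_le_of_sum_le hpC, fun s hs => ?_⟩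
  have hgeo : Summable fun k : ℕ => C * s ^ k :=
    (summable_geometric_of_lt_one hs.1.le hs.2).mul_left C
  -- Each coefficient is at most the total mass, so C s^k dominates. This needs s < 1: mass may
  -- still escape at s = 1.
  have ht : Tendsto (fun n => ∑' k, a n k * s ^ k) atTop (𝓝 (∑' k, p k * s ^ k)) := by
    refine tendsto_tsum_of_dominated_convergence hgeo (fun k => (hp k).mul_const _) ?_
    filter_upwards [hC] with n hn k
    rw [Real.norm_of_nonneg (mul_nonneg (ha n k) (pow_nonneg hs.1.le _))]
    exact mul_le_mul_of_nonneg_right ((hn.1.le_tsum k fun j _ => ha n j).trans hn.2)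
      (pow_nonneg hs.1.le _)
  have hsp : Summable fun k => p k * s ^ k :=
    Summable.of_nonneg_of_le (fun k => mul_nonneg (hp0 k) (pow_nonneg hs.1.le _))
      (fun k => mul_le_of_le_one_right (hp0 k) (pow_le_one₀ hs.1.le hs.2.le)) hps
  rw [tendsto_nhds_unique (hH s hs) ht]
  exact hsp.hasSum

lemma continuousOn_tsum_mul_pow {p : ℕ → ℝ} (hp0 : ∀ k, 0 ≤ p k) (hp : Summable p) :
    ContinuousOn (fun s : ℝ => ∑' k, p k * s ^ k) (Set.Icc 0 1) := by
  refine continuousOn_tsum (fun k => by fun_prop) hp fun k s hs => ?_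
  rw [Real.norm_of_nonneg (mul_nonneg (hp0 k) (pow_nonneg hs.1 _))]
  exact mul_le_of_le_one_right (hp0 k) (pow_le_one₀ hs.1 hs.2)

/-- An identity of continuous functions on `(0, 1)` extends to `[0, 1]`. -/
lemma eqOn_Icc_of_eqOn_Ioo {f g : ℝ → ℝ} (hf : ContinuousOn f (Set.Icc 0 1))
    (hg : ContinuousOn g (Set.Icc 0 1)) (h : Set.EqOn f g (Set.Ioo 0 1)) :
    Set.EqOn f g (Set.Icc 0 1) := by
  refine h.of_subset_closure hf hg Set.Ioo_subset_Icc_self ?_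
  rw [closure_Ioo (by norm_num)]

/-- Every subset of ℕ is a countable union of points, so Fatou's lemma for the counting measure
gives the portmanteau inequality for open sets. -/
lemma probabilityMeasure_nat_tendsto {μ : ℕ → ProbabilityMeasure ℕ} {μ₀ : ProbabilityMeasure ℕ}
    (h : ∀ k : ℕ, Tendsto (fun n => (μ n : Measure ℕ) {k}) atTop (𝓝 ((μ₀ : Measure ℕ) {k}))) :
    Tendsto μ atTop (𝓝 μ₀) := by
  refine tendsto_of_forall_isOpen_le_liminf' fun G _ => ?_
  have e : ∀ m : Measure ℕ, m G = ∑' k : ℕ, G.indicator (fun k => m {k}) k := fun m => by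
    have h1 := m.tsum_indicator_apply_singleton G (Set.to_countable G).measurableSet
    exact h1.symm
  simp only [e]
  rw [← lintegral_count]
  have h2 : ∀ k, G.indicator (fun k => (μ₀ : Measure ℕ) {k}) k =
      liminf (fun n => G.indicator (fun k => (μ n : Measure ℕ) {k}) k) atTop := fun k => by
    by_cases hk : k ∈ G
    · simp only [hk, Set.indicator_of_mem]
      exact (h k).liminf_eq.symm
    · simp [hk]
  simp only [h2]
  refine (lintegral_liminf_le fun n => measurable_of_countable _).trans (le_of_eq ?_)
  simp only [lintegral_count]

variable {Ω : Type*} [MeasurableSpace Ω] {P : Measure Ω} [IsProbabilityMeasure P]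

/-- Continuity theorem for probability generating functions. -/
lemma exists_tendstoInDistribution_of_pgf {Y : ℕ → Ω → ℕ} (hY : ∀ n, Measurable (Y n)) {H : ℝ → ℝ}
    (hH : ContinuousOn H (Set.Icc 0 1)) (h1 : H 1 = 1)
    (h : ∀ s ∈ Set.Ioo (0 : ℝ) 1, Tendsto (fun n => pgf P (Y n) s) atTop (𝓝 (H s))) :
    ∃ (μ : Measure ℕ) (_ : IsProbabilityMeasure μ),
      TendstoInDistribution Y atTop (id : ℕ → ℕ) (fun _ => P) μ ∧
      ∀ s ∈ Set.Icc (0 : ℝ) 1, ∫ k, s ^ k ∂μ = H s := by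
  have hone : ∀ n, HasSum (fun k => P.real {ω | Y n ω = k}) 1 := fun n => by
    simpa [pgf_one] using hasSum_pgf (P := P) (hY n) (s := 1) (by simp)
  obtain ⟨p, hp, hp0, hps, -, hpH⟩ := exists_tendsto_coeff
    (a := fun n k => P.real {ω | Y n ω = k}) (fun n k => measureReal_nonneg) (C := 1)
    (Eventually.of_forall fun n => ⟨(hone n).summable, (hone n).tsum_eq.le⟩)
    (fun s hs => (h s hs).congr fun n =>
      ((hasSum_pgf (hY n) (Set.Ioo_subset_Icc_self hs)).tsum_eq).symm)
  have heq := eqOn_Icc_of_eqOn_Ioo (continuousOn_tsum_mul_pow hp0 hps) hH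
    fun s hs => (hpH s hs).tsum_eq
  -- Continuity of H at 1 together with H(1) = 1 excludes an escape of mass.
  have hp1 : HasSum p 1 := by
    have := heq (Set.right_mem_Icc.2 zero_le_one)
    simp only [one_pow, mul_one, h1] at this
    exact this ▸ hps.hasSum
  let q : PMF ℕ := ⟨fun k => ENNReal.ofReal (p k), by
    have := ENNReal.ofReal_tsum_of_nonneg hp0 hps
    rw [hp1.tsum_eq, ENNReal.ofReal_one] at this
    rw [this]
    exact ENNReal.summable.hasSum⟩
  have hq : ∀ k, q.toMeasure {k} = ENNReal.ofReal (p k) := fun k =>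
    q.toMeasure_apply_singleton k (measurableSet_singleton k)
  refine ⟨q.toMeasure, inferInstance, ⟨fun n => (hY n).aemeasurable, aemeasurable_id, ?_⟩, ?_⟩
  · refine probabilityMeasure_nat_tendsto fun k => ?_
    simp only [ProbabilityMeasure.coe_mk, Measure.map_id, hq]
    refine (ENNReal.tendsto_ofReal (hp k)).congr fun n => ?_
    rw [Measure.map_apply (hY n) (measurableSet_singleton k), ofReal_measureReal]
    rfl
  · intro s hs
    rw [← heq hs]
    have hint : Integrable (fun k : ℕ => s ^ k) q.toMeasure := by
      refine Integrable.of_bound (measurable_of_countable _).aestronglyMeasurable 1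
        (ae_of_all _ fun k => ?_)
      rw [Real.norm_of_nonneg (pow_nonneg hs.1 _)]
      exact pow_le_one₀ hs.1 hs.2
    rw [integral_countable hint]
    refine tsum_congr fun k => ?_
    rw [measureReal_def, hq, ENNReal.toReal_ofReal (hp0 k), smul_eq_mul]

end NearlyCritical

/-! ### The limit exponent and convergence in distribution -/

namespace NearlyCritical

/-- The power series `∑_{k ≥ 0} (-1) ^ k lam_{k+1} x ^ k`. -/
noncomputable def alternatingSeries (lam : ℕ → ℝ≥0) (x : ℝ) : ℝ :=
  ∑' k : ℕ, (-1) ^ k * (lam (k + 1) : ℝ) * x ^ k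

/-- The integrand of the exponent of the limit generating function. -/
noncomputable def exponentDensity (ν : ℝ≥0) (lam : ℕ → ℝ≥0) (x : ℝ) : ℝ :=
  alternatingSeries lam x / (1 + ν / 2 * x)

/-- The exponent of the limit generating function. -/
noncomputable def limitExponent (ν : ℝ≥0) (lam : ℕ → ℝ≥0) (x : ℝ) : ℝ :=
  ∫ u in (0 : ℝ)..x, exponentDensity ν lam u

variable {ν : ℝ≥0} {lam : ℕ → ℝ≥0}

lemma norm_alternating_term_le (lam : ℕ → ℝ≥0) (k : ℕ) {x : ℝ} (hx : x ∈ Set.Icc (0 : ℝ) 1) :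
    ‖(-1) ^ k * (lam (k + 1) : ℝ) * x ^ k‖ ≤ lam (k + 1) := by
  rw [norm_mul, norm_mul, norm_pow, norm_neg, norm_one, one_pow, one_mul, norm_pow,
    Real.norm_of_nonneg hx.1, Real.norm_of_nonneg (NNReal.coe_nonneg _)]
  exact mul_le_of_le_one_right (NNReal.coe_nonneg _) (pow_le_one₀ hx.1 hx.2)

lemma continuousOn_alternatingSeries (hlam : Summable fun k => (lam (k + 1) : ℝ)) :
    ContinuousOn (alternatingSeries lam) (Set.Icc 0 1) :=
  continuousOn_tsum (fun k => by fun_prop) hlam fun k _ hx => norm_alternating_term_le lam k hx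

lemma one_add_half_mul_pos (ν : ℝ≥0) {x : ℝ} (hx : 0 ≤ x) : 0 < 1 + (ν : ℝ) / 2 * x := by
  have := ν.coe_nonneg
  positivity

lemma continuousOn_exponentDensity (ν : ℝ≥0) (hlam : Summable fun k => (lam (k + 1) : ℝ)) :
    ContinuousOn (exponentDensity ν lam) (Set.Icc 0 1) :=
  (continuousOn_alternatingSeries hlam).div (by fun_prop) fun _ hx =>
    (one_add_half_mul_pos ν hx.1).ne'

lemma continuousOn_limitExponent (ν : ℝ≥0) (hlam : Summable fun k => (lam (k + 1) : ℝ)) :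
    ContinuousOn (limitExponent ν lam) (Set.Icc 0 1) := by
  have h := (continuousOn_exponentDensity ν hlam).integrableOn_Icc (μ := volume)
  have := intervalIntegral.continuousOn_primitive_interval (a := 0) (b := 1)
    (f := exponentDensity ν lam) (μ := volume) (by rwa [Set.uIcc_of_le zero_le_one])
  rwa [Set.uIcc_of_le zero_le_one] at this

lemma abs_mul_alternatingSeries_sub_le (hlam : Summable fun k => (lam (k + 1) : ℝ)) {K : ℕ}
    (hK : 1 ≤ K) {x : ℝ} (hx : x ∈ Set.Icc (0 : ℝ) 1) :
    |x * alternatingSeries lam x - ∑ k ∈ Finset.Ico 1 K, (-1) ^ (k + 1) * (lam k : ℝ) * x ^ k| ≤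
      (∑' k, (lam (k + K) : ℝ)) * x := by
  obtain ⟨K, rfl⟩ : ∃ L, K = L + 1 := ⟨K - 1, by omega⟩
  have hs : Summable fun k => (-1) ^ k * (lam (k + 1) : ℝ) * x ^ k :=
    Summable.of_norm_bounded hlam fun k => norm_alternating_term_le lam k hx
  have e1 : ∑ k ∈ Finset.Ico 1 (K + 1), (-1) ^ (k + 1) * (lam k : ℝ) * x ^ k =
      x * ∑ k ∈ Finset.range K, (-1) ^ k * (lam (k + 1) : ℝ) * x ^ k := by
    rw [Finset.sum_Ico_eq_sum_range, Finset.mul_sum, Nat.add_sub_cancel]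
    refine Finset.sum_congr rfl fun k _ => ?_
    rw [add_comm 1 k]
    ring
  have hs' : Summable fun k => (lam (k + K + 1) : ℝ) := (summable_nat_add_iff K).2 hlam
  have e2 : ‖∑' k, (-1) ^ (k + K) * (lam (k + K + 1) : ℝ) * x ^ (k + K)‖ ≤
      ∑' k, (lam (k + K + 1) : ℝ) :=
    tsum_of_norm_bounded hs'.hasSum fun k => norm_alternating_term_le lam (k + K) hx
  rw [e1, ← mul_sub, alternatingSeries, ← hs.sum_add_tsum_nat_add K, add_sub_cancel_left, abs_mul,
    abs_of_nonneg hx.1, mul_comm]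
  exact mul_le_mul_of_nonneg_right e2 hx.1

/-- The finite sum subtracts the Taylor polynomial of log(1 + cx), and the integral is the
remainder. The induction peels off one monomial through -cu / (1 + cu) = 1 / (1 + cu) - 1. -/
lemma log_add_sum_eq_integral {c : ℝ} (hc : 0 ≤ c) {x : ℝ} (hx : 0 ≤ x) (k : ℕ) :
    Real.log (1 + c * x) + ∑ i ∈ Finset.Ico 1 (k + 1), (-1) ^ i * (c ^ i / i) * x ^ i =
      ∫ u in (0 : ℝ)..x, c * (-(c * u)) ^ k / (1 + c * u) := by
  have hpos : ∀ u ∈ Set.uIcc 0 x, 1 + c * u ≠ 0 := fun u hu => by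
    rw [Set.uIcc_of_le hx] at hu
    have := hu.1
    positivity
  have hint : ∀ k : ℕ, IntervalIntegrable (fun u => c * (-(c * u)) ^ k / (1 + c * u)) volume 0 x :=
    fun k => ContinuousOn.intervalIntegrable (ContinuousOn.div (by fun_prop) (by fun_prop) hpos)
  induction k with
  | zero =>
    have := intervalIntegral.integral_eq_sub_of_hasDerivAt
      (f := fun u => Real.log (1 + c * u)) (f' := fun u => c * (-(c * u)) ^ 0 / (1 + c * u))
      (a := 0) (b := x) (fun u hu => by
        have h1 : HasDerivAt (fun u => 1 + c * u) c u := by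
          simpa using ((hasDerivAt_id u).const_mul c).const_add 1
        simpa using h1.log (hpos u hu)) (hint 0)
    rw [this]
    simp
  | succ k ih =>
    rw [Finset.sum_Ico_succ_top (by omega), ← add_assoc, ih]
    have e1 : ∫ u in (0 : ℝ)..x, c * (-(c * u)) ^ (k + 1) / (1 + c * u) =
        ∫ u in (0 : ℝ)..x, (c * (-(c * u)) ^ k / (1 + c * u) - c * (-c) ^ k * u ^ k) := by
      refine intervalIntegral.integral_congr fun u hu => ?_
      have := hpos u hu
      rw [← neg_mul, mul_pow, mul_pow]
      field_simp
      ring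
    rw [e1, intervalIntegral.integral_sub (hint k)
      (Continuous.intervalIntegrable (by fun_prop) _ _), intervalIntegral.integral_const_mul,
      integral_pow, neg_pow c]
    push_cast
    field_simp
    ring

/-- The prefactor (2/ν)^{k+1} cancels the powers of ν/2 in the Taylor remainder. The resulting
formula has no singularity at ν = 0 and covers that case as well. -/
lemma logTerm_eq_integral (ν : ℝ≥0) (lam : ℕ → ℝ≥0) (k : ℕ) {s : ℝ} (hs : s ≤ 1) :
    logTerm ν lam (k + 1) s =
      ∫ u in (0 : ℝ)..(1 - s), (-1) ^ k * (lam (k + 1) : ℝ) * u ^ k / (1 + ν / 2 * u) := by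
  rcases eq_or_ne ν 0 with rfl | hν
  · simp only [logTerm, if_true, NNReal.coe_zero, zero_div, zero_mul, add_zero, div_one]
    rw [intervalIntegral.integral_const_mul, integral_pow]
    push_cast
    simp
    ring
  · have hν' : (ν : ℝ) ≠ 0 := NNReal.coe_ne_zero.2 hν
    have e := log_add_sum_eq_integral (c := ν / 2) (by have := ν.coe_nonneg; positivity)
      (sub_nonneg.2 hs) k
    have e1 : ∑ i ∈ Finset.Ico 1 (k + 1), (-1) ^ i * ((ν : ℝ) ^ i / (i * 2 ^ i)) * (1 - s) ^ i =
        ∑ i ∈ Finset.Ico 1 (k + 1), (-1) ^ i * (((ν : ℝ) / 2) ^ i / i) * (1 - s) ^ i := by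
      refine Finset.sum_congr rfl fun i _ => ?_
      rw [div_pow, div_div, mul_comm (2 ^ i : ℝ)]
    rw [logTerm, if_neg hν, e1, e, ← intervalIntegral.integral_const_mul]
    refine intervalIntegral.integral_congr fun u hu => ?_
    rw [← mul_div_assoc]
    congr 1
    rw [← neg_one_mul, mul_pow, mul_pow, div_pow]
    field_simp
    ring

lemma hasSum_logTerm (ν : ℝ≥0) (hlam : Summable fun k => (lam (k + 1) : ℝ)) {s : ℝ}
    (hs : s ∈ Set.Icc (0 : ℝ) 1) :
    HasSum (fun k => logTerm ν lam (k + 1) s) (limitExponent ν lam (1 - s)) := by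
  simp only [logTerm_eq_integral ν lam _ hs.2]
  have hsub : Set.uIoc 0 (1 - s) ⊆ Set.Icc (0 : ℝ) 1 := by
    rw [Set.uIoc_of_le (by linarith [hs.2])]
    exact fun u hu => ⟨hu.1.le, hu.2.trans (by linarith [hs.1])⟩
  refine intervalIntegral.hasSum_integral_of_dominated_convergence
    (fun k _ => (lam (k + 1) : ℝ)) (fun k => ?_) (fun k => ae_of_all _ fun u hu => ?_)
    (ae_of_all _ fun _ _ => hlam) (by simp) (ae_of_all _ fun u hu => ?_)
  · refine Measurable.aestronglyMeasurable ?_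
    fun_prop
  · have hu := hsub hu
    have h1 : 1 ≤ 1 + (ν : ℝ) / 2 * u := by
      have := ν.coe_nonneg
      have := hu.1
      have : 0 ≤ (ν : ℝ) / 2 * u := by positivity
      linarith
    rw [norm_div]
    refine (div_le_self (norm_nonneg _) ?_).trans (norm_alternating_term_le lam k hu)
    rw [Real.norm_of_nonneg (by linarith)]
    exact h1
  · have hu := hsub hu
    exact (Summable.of_norm_bounded hlam fun k =>
      norm_alternating_term_le lam k hu).hasSum.div_const _

variable {Ω : Type*} [MeasurableSpace Ω] {P : Measure Ω}
  {ξ : ℕ → ℕ → Ω → ℕ} {ε : ℕ → Ω → ℕ}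

/-- The limits of the factorial moments exist up to orders beyond which the sum of the limits is
arbitrarily small. -/
def ImmigrationMoments (P : Measure Ω) (ξ : ℕ → ℕ → Ω → ℕ) (ε : ℕ → Ω → ℕ) (lam : ℕ → ℝ≥0) :
    Prop :=
  ∀ τ : ℝ, 0 < τ → ∃ K, 1 ≤ K ∧ (∀ k, 1 ≤ k → k ≤ K → ImmigrationLimit P ξ ε k (lam k)) ∧
    ∑' k, (lam (k + K) : ℝ) ≤ τ

variable [IsProbabilityMeasure P]

lemma ImmigrationMoments.eventually_abs_one_sub_pgf_sub_le (hε : ∀ n, Measurable (ε n))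
    (hoff : NearlyCriticalOffspring P ξ ν) (hlam : Summable fun k => (lam (k + 1) : ℝ))
    (h : ImmigrationMoments P ξ ε lam) {τ : ℝ} (hτ : 0 < τ) :
    ∀ᶠ n in atTop, ∀ x ∈ Set.Icc (0 : ℝ) 1,
      |1 - pgf P (ε n) (1 - x) - (meanDefect P ξ n).toReal * (x * alternatingSeries lam x)| ≤
        τ * (meanDefect P ξ n).toReal * x := by
  -- The tail from K on contains λ_K, so λ_K ≤ τ/3 < 2τ/3. The expansion of order K costs 2τ/3 and
  -- replacing its polynomial by the full series costs τ/3.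
  obtain ⟨K, hK, hlim, htail⟩ := h (τ / 3) (by positivity)
  have hs : Summable fun k => (lam (k + K) : ℝ) := by
    obtain ⟨K, rfl⟩ : ∃ L, K = L + 1 := ⟨K - 1, by omega⟩
    exact (summable_nat_add_iff K).2 hlam
  have hlK : (lam K : ℝ) ≤ τ / 3 := by
    have := hs.le_tsum 0 fun j _ => (lam _).2
    rw [zero_add] at this
    exact this.trans htail
  filter_upwards [eventually_abs_one_sub_pgf_sub_sum_le hε hoff.defect_pos
    (l := fun k => (lam k : ℝ)) hK
    (fun k h1 h2 => (hlim k h1 h2).eventually_ne_top) (fun k h1 h2 => (hlim k h1 h2).tendsto_div)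
    (by linarith : (lam K : ℝ) < 2 * τ / 3)] with n hn x hx
  have hd := hoff.defect_pos n
  have e1 := hn x hx
  have e2 := (abs_mul_alternatingSeries_sub_le hlam hK hx).trans
    (mul_le_mul_of_nonneg_right htail hx.1)
  set d := (meanDefect P ξ n).toReal
  set S := ∑ k ∈ Finset.Ico 1 K, (-1) ^ (k + 1) * (lam k : ℝ) * x ^ k
  have e3 : 1 - pgf P (ε n) (1 - x) - d * (x * alternatingSeries lam x) =
      (1 - pgf P (ε n) (1 - x) - d * S) - d * (x * alternatingSeries lam x - S) := by ring
  have e4 := mul_le_mul_of_nonneg_left e2 hd.le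
  rw [e3]
  refine (abs_sub _ _).trans ?_
  rw [abs_mul, abs_of_pos hd]
  linarith

lemma Model.hasLimitPGF (hmodel : Model P ξ ε) (hoff : NearlyCriticalOffspring P ξ ν)
    (hlam : Summable fun k => (lam (k + 1) : ℝ)) (h : ImmigrationMoments P ξ ε lam) :
    HasLimitPGF P ξ ε fun s => Real.exp (-limitExponent ν lam (1 - s)) := by
  have hflip : ∀ {x : ℝ}, x ∈ Set.Icc (0 : ℝ) 1 → 1 - x ∈ Set.Icc (0 : ℝ) 1 := fun hx =>
    ⟨by linarith [hx.2], by linarith [hx.1]⟩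
  have hΦ := continuousOn_limitExponent ν hlam
  have hΦ0 : limitExponent ν lam 0 = 0 := by simp [limitExponent]
  have hξ : ∀ n, Measurable (ξ n 0) := fun n => hmodel.measurable_offspring n 0
  have ha : ∀ n, ∀ x ∈ Set.Icc (0 : ℝ) 1, 1 - pgf P (ξ n 0) (1 - x) ∈ Set.Icc (0 : ℝ) 1 :=
    fun n x hx => hflip (pgf_mem_Icc (hξ n) (hflip hx))
  refine exists_tendstoInDistribution_of_pgf hmodel.measurable_process
    (Real.continuous_exp.comp_continuousOn
      (hΦ.comp (by fun_prop : ContinuousOn (fun s : ℝ => 1 - s) _) fun s hs => hflip hs).neg)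
    (by simp [hΦ0]) fun s hs => ?_
  have key := tendsto_of_contracting_recursion (d := fun n => (meanDefect P ξ n).toReal)
    (F := fun n x => pgf P (process ξ ε n) (1 - x))
    (a := fun n x => 1 - pgf P (ξ n 0) (1 - x)) (g := fun n x => pgf P (ε n) (1 - x))
    (G := fun x => Real.exp (-limitExponent ν lam x))
    (fun n => (hoff.defect_pos n).le) (defect_le_one P ξ) hoff.not_summable_defect
    (fun n x hx => by
      rw [hmodel.pgf_process_succ n (hflip hx), sub_sub_cancel])
    ha
    (fun n x hx => by
      rw [← hoff.mean_eq]
      exact one_sub_pgf_le (hξ n) ((hoff.mean_lt_one n).trans ENNReal.one_lt_top).ne hx)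
    (fun n x hx => by
      have := pgf_mem_Icc (P := P) (hmodel.measurable_immigration n) (hflip hx)
      rw [abs_of_nonneg this.1]
      exact this.2)
    (fun n => (continuousOn_pgf (hmodel.measurable_process n)).comp (by fun_prop)
      fun s hs => hflip hs)
    (fun n => by simp [pgf_one])
    (Real.continuous_exp.comp_continuousOn hΦ.neg) (by simp [hΦ0]) (fun τ hτ => ?_)
    (hflip (Set.Ioo_subset_Icc_self hs))
  · simpa using key
  -- Factoring out G(a_n(x)), bounded by M, reduces approximate invariance to the comparison of
  -- exp(-w) with g_n; M + 1 serves as a positive divisor.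
  · obtain ⟨M, hM⟩ := isCompact_Icc.exists_bound_of_continuousOn
      (Real.continuous_exp.comp_continuousOn hΦ.neg)
    have hM0 : 0 ≤ M := (norm_nonneg _).trans (hM 0 (by simp))
    filter_upwards [eventually_abs_exp_sub_le (τ := τ / (M + 1))
      (continuousOn_exponentDensity ν hlam) ν.coe_nonneg hoff.defect_pos
      hoff.tendsto_defect ha
      (fun τ hτ => (hoff.eventually_abs_one_sub_pgf_sub_le hmodel.measurable_offspring hτ))
      (g := fun n x => pgf P (ε n) (1 - x))
      (fun τ hτ => (h.eventually_abs_one_sub_pgf_sub_le hmodel.measurable_immigration hoff hlam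
        hτ).mono fun n hn x hx => by
          -- The equation that determines the density of the exponent.
          have e : x * (1 + (ν : ℝ) * x / 2) * exponentDensity ν lam x =
              x * alternatingSeries lam x := by
            have := one_add_half_mul_pos ν hx.1
            rw [exponentDensity, show 1 + (ν : ℝ) * x / 2 = 1 + (ν : ℝ) / 2 * x by ring]
            rw [mul_assoc, mul_div_cancel₀ _ this.ne']
          rw [e]
          exact hn x hx) (by positivity)] with n hn x hx
    have hn := hn x hx
    have hy := hM _ (ha n x hx)
    set y := 1 - pgf P (ξ n 0) (1 - x)
    set d := (meanDefect P ξ n).toReal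
    have hdx : 0 ≤ d * x := mul_nonneg (hoff.defect_pos n).le hx.1
    have e : Real.exp (-limitExponent ν lam x) -
        Real.exp (-limitExponent ν lam y) * pgf P (ε n) (1 - x) =
        Real.exp (-limitExponent ν lam y) *
        (Real.exp (-(limitExponent ν lam x - limitExponent ν lam y)) - pgf P (ε n) (1 - x)) := by
      rw [mul_sub, ← Real.exp_add]
      congr 2
      ring
    rw [e, abs_mul]
    calc _ ≤ M * (τ / (M + 1) * d * x) := mul_le_mul hy hn (abs_nonneg _) hM0
      _ ≤ (M + 1) * (τ / (M + 1) * (d * x)) := by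
        rw [mul_assoc (τ / (M + 1))]
        have : 0 ≤ τ / (M + 1) * (d * x) := by positivity
        gcongr
        linarith
      _ = τ * d * x := by field_simp

end NearlyCritical

/-! ### The compound Poisson form -/

namespace NearlyCritical

section Tail

/-- The tail `∑_{j > i} q_j`. -/
noncomputable def tailSum (q : ℕ → ℝ≥0) (i : ℕ) : ℝ := ∑' j, (q (j + i + 1) : ℝ)

variable {q : ℕ → ℝ≥0}

lemma tailSum_nonneg (q : ℕ → ℝ≥0) (i : ℕ) : 0 ≤ tailSum q i :=
  tsum_nonneg fun _ => NNReal.coe_nonneg _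

lemma tailSum_eq_add (hq : Summable fun j => (q (j + 1) : ℝ)) (i : ℕ) :
    tailSum q i = q (i + 1) + tailSum q (i + 1) := by
  have h : Summable fun j => (q (j + i + 1) : ℝ) := (summable_nat_add_iff i).2 hq
  rw [tailSum, h.tsum_eq_zero_add, zero_add, tailSum]
  simp only [add_right_comm _ 1 i, add_assoc]

lemma tailSum_le_zero (hq : Summable fun j => (q (j + 1) : ℝ)) (i : ℕ) :
    tailSum q i ≤ tailSum q 0 := by
  induction i with
  | zero => exact le_rfl
  | succ i ih => linarith [tailSum_eq_add hq i, (q (i + 1)).coe_nonneg]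

lemma hasSum_ite_tailSum (hq : Summable fun j => (q (j + 1) : ℝ)) (i : ℕ) :
    HasSum (fun j => if i ≤ j then (q (j + 1) : ℝ) else 0) (tailSum q i) := by
  have h : HasSum (fun j => (q (j + i + 1) : ℝ)) (tailSum q i) :=
    ((summable_nat_add_iff i).2 hq).hasSum
  rw [← hasSum_nat_add_iff' i]
  have e : ∑ j ∈ Finset.range i, (if i ≤ j then (q (j + 1) : ℝ) else 0) = 0 :=
    Finset.sum_eq_zero fun j hj => if_neg (not_le.2 (Finset.mem_range.1 hj))
  simpa [e] using h

/-- Summation by parts, from the fact that q_{i+1} is the difference of the consecutive tails i and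
i + 1. -/
lemma hasSum_tailSum_mul_pow (hq : Summable fun j => (q (j + 1) : ℝ)) {x : ℝ}
    (hx : x ∈ Set.Ioo (0 : ℝ) 1) :
    HasSum (fun i => tailSum q i * x ^ i)
      ((tailSum q 0 - ∑' j, (q (j + 1) : ℝ) * x ^ (j + 1)) / (1 - x)) := by
  have hs : Summable fun i => tailSum q i * x ^ i :=
    Summable.of_nonneg_of_le (fun i => mul_nonneg (tailSum_nonneg q i) (pow_nonneg hx.1.le _))
      (fun i => mul_le_mul_of_nonneg_right (tailSum_le_zero hq i) (pow_nonneg hx.1.le _))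
      ((summable_geometric_of_lt_one hx.1.le hx.2).mul_left _)
  have h1 : Summable fun i => tailSum q (i + 1) * x ^ (i + 1) :=
    (summable_nat_add_iff (f := fun i => tailSum q i * x ^ i) 1).2 hs
  have e : ∑' j, (q (j + 1) : ℝ) * x ^ (j + 1) =
      x * ∑' i, tailSum q i * x ^ i - ∑' i, tailSum q (i + 1) * x ^ (i + 1) := by
    rw [← tsum_mul_left, ← (hs.mul_left x).tsum_sub h1]
    refine tsum_congr fun i => ?_
    rw [tailSum_eq_add hq i]
    ring
  have e2 := hs.tsum_eq_zero_add
  have hx' : 1 - x ≠ 0 := by linarith [hx.2]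
  have e3 : (tailSum q 0 - ∑' j, (q (j + 1) : ℝ) * x ^ (j + 1)) / (1 - x) =
      ∑' i, tailSum q i * x ^ i := by
    rw [div_eq_iff hx', e]
    simp only [pow_zero, mul_one] at e2
    linear_combination -e2
  rw [e3]
  exact hs.hasSum

lemma one_sub_mul_sum_pow (r : ℝ) {N m : ℕ} (hm : m ≤ N + 1) :
    (1 - r) * ∑ i ∈ Finset.range m, r ^ (N - i) = r ^ (N + 1 - m) - r ^ (N + 1) := by
  induction m with
  | zero => simp
  | succ m ih =>
    rw [Finset.sum_range_succ, mul_add, ih (by omega), Nat.add_sub_add_right,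
      show N + 1 - m = N - m + 1 by omega, pow_succ]
    ring

/-- Exchange the sums: q_{j+1} occurs in the tails i ≤ j, so its weight is a geometric sum over i <
min(j + 1, N + 1). It telescopes to r^{N+1} times the bracket of A_{N+1}, because 1 + 2/ν = 1/r. -/
lemma coeffA_succ_eq (ν : ℝ≥0) (hq : Summable fun j => (q (j + 1) : ℝ)) (N : ℕ) :
    coeffA ν q (N + 1) = (∑ i ∈ Finset.range (N + 1),
      tailSum q i * ((1 - ν / (2 + ν)) * ((ν : ℝ) / (2 + ν)) ^ (N - i))) / (N + 1) := by
  have hν0 := ν.coe_nonneg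
  rcases eq_or_ne ν 0 with rfl | hν
  -- Here r = 0, and 0^0 = 1 leaves only the term i = N.
  · rw [coeffA, if_pos rfl, Finset.sum_eq_single N]
    · simp only [add_le_add_iff_right, (hasSum_ite_tailSum hq N).tsum_eq]
      simp
      ring
    · intro i hi hiN
      have : N - i ≠ 0 := by have := Finset.mem_range.1 hi; omega
      simp [this]
    · simp
  · have hν' : (0 : ℝ) < ν := NNReal.coe_pos.2 (pos_iff_ne_zero.2 hν)
    set r : ℝ := ν / (2 + ν) with hr
    have hr0 : 0 < r := by positivity
    have h1 : HasSum (fun j => ∑ i ∈ Finset.range (N + 1),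
        (if i ≤ j then (q (j + 1) : ℝ) else 0) * ((1 - r) * r ^ (N - i)))
        (∑ i ∈ Finset.range (N + 1), tailSum q i * ((1 - r) * r ^ (N - i))) :=
      hasSum_sum fun i _ => (hasSum_ite_tailSum hq i).mul_right _
    have h2 : ∀ j, ∑ i ∈ Finset.range (N + 1),
        (if i ≤ j then (q (j + 1) : ℝ) else 0) * ((1 - r) * r ^ (N - i)) =
        r ^ (N + 1) * ((q (j + 1) : ℝ) * ((1 + 2 / (ν : ℝ)) ^ min (j + 1) (N + 1) - 1)) := by
      intro j
      have e1 : ∑ i ∈ Finset.range (N + 1),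
          (if i ≤ j then (q (j + 1) : ℝ) else 0) * ((1 - r) * r ^ (N - i)) =
          q (j + 1) * ((1 - r) * ∑ i ∈ Finset.range (min (j + 1) (N + 1)), r ^ (N - i)) := by
        have hsub : (Finset.range (N + 1)).filter (fun i => i ≤ j) =
            Finset.range (min (j + 1) (N + 1)) := by
          ext i; simp; omega
        rw [← hsub, Finset.sum_filter, Finset.mul_sum, Finset.mul_sum]
        refine Finset.sum_congr rfl fun i _ => ?_
        split_ifs <;> simp
      have e2 : 1 + 2 / (ν : ℝ) = r⁻¹ := by rw [hr, inv_div]; field_simp; ring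
      have hm : min (j + 1) (N + 1) ≤ N + 1 := min_le_right _ _
      rw [e1, one_sub_mul_sum_pow r hm, e2, inv_pow, pow_sub₀ _ hr0.ne' hm]
      ring
    simp only [h2] at h1
    rw [coeffA, if_neg hν, ← h1.tsum_eq, tsum_mul_left, hr, div_pow]
    push_cast
    field_simp

end Tail

variable {ν : ℝ≥0} {lam q : ℕ → ℝ≥0}

/-- The expansion of the limit exponent in powers of `s`. -/
lemma hasSum_coeffA (ν : ℝ≥0) (hlam : Summable fun k => (lam (k + 1) : ℝ))
    (hq : Summable fun j => (q (j + 1) : ℝ))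
    (h : ∀ x ∈ Set.Icc (0 : ℝ) 1, ∑' j, (q (j + 1) : ℝ) * x ^ (j + 1) =
      alternatingSeries lam 1 - (1 - x) * alternatingSeries lam (1 - x)) {s : ℝ}
    (hs : s ∈ Set.Icc (0 : ℝ) 1) :
    HasSum (fun n => coeffA ν q (n + 1) * (s ^ (n + 1) - 1)) (-limitExponent ν lam (1 - s)) := by
  have hν0 := ν.coe_nonneg
  have hflip : ∀ {x : ℝ}, x ∈ Set.Icc (0 : ℝ) 1 → 1 - x ∈ Set.Icc (0 : ℝ) 1 := fun hx =>
    ⟨by linarith [hx.2], by linarith [hx.1]⟩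
  have hQ0 : tailSum q 0 = alternatingSeries lam 1 := by
    have := h 1 (by simp)
    simpa [tailSum] using this
  have hQ : ∀ x ∈ Set.Ioo (0 : ℝ) 1,
      HasSum (fun i => tailSum q i * x ^ i) (alternatingSeries lam (1 - x)) := by
    intro x hx
    have := hasSum_tailSum_mul_pow hq hx
    have hx' : 1 - x ≠ 0 := by linarith [hx.2]
    rwa [h x (Set.Ioo_subset_Icc_self hx), hQ0, sub_sub_cancel, mul_div_cancel_left₀ _ hx'] at this
  have hAc : ContinuousOn (fun x => alternatingSeries lam (1 - x)) (Set.Icc 0 1) :=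
    (continuousOn_alternatingSeries hlam).comp (by fun_prop) fun x hx => hflip hx
  obtain ⟨B, hB⟩ := isCompact_Icc.exists_bound_of_continuousOn hAc
  -- The terms are nonnegative and A is bounded on [0, 1], so letting x ↑ 1 bounds every partial
  -- sum. Hence the expansions hold up to x = 1, where the integration ends.
  have hQs : Summable (tailSum q) := by
    refine summable_of_sum_range_le (c := B) (tailSum_nonneg q) fun M => ?_
    have ht : Tendsto (fun x : ℝ => ∑ i ∈ Finset.range M, tailSum q i * x ^ i) (𝓝[<] 1)
        (𝓝 (∑ i ∈ Finset.range M, tailSum q i * 1 ^ i)) :=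
      (Continuous.tendsto (by fun_prop) 1).mono_left nhdsWithin_le_nhds
    simp only [one_pow, mul_one] at ht
    refine le_of_tendsto ht ?_
    filter_upwards [Ioo_mem_nhdsLT (zero_lt_one : (0 : ℝ) < 1)] with x hx
    have h1 := (hQ x hx).summable.sum_le_tsum (Finset.range M) fun i _ =>
      mul_nonneg (tailSum_nonneg q i) (pow_nonneg hx.1.le _)
    rw [(hQ x hx).tsum_eq] at h1
    exact h1.trans ((le_abs_self _).trans (hB x (Set.Ioo_subset_Icc_self hx)))
  have hQI : ∀ x ∈ Set.Icc (0 : ℝ) 1,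
      ∑' i, tailSum q i * x ^ i = alternatingSeries lam (1 - x) :=
    eqOn_Icc_of_eqOn_Ioo (continuousOn_tsum_mul_pow (tailSum_nonneg q) hQs) hAc
      fun x hx => (hQ x hx).tsum_eq
  set r : ℝ := ν / (2 + ν) with hr
  have hr0 : 0 ≤ r := by positivity
  have hr1 : r < 1 := by rw [hr, div_lt_one (by positivity)]; linarith
  -- Coefficients of the Cauchy product of the tail series with (1 - r) / (1 - r x) = 1 / (1 + ν(1 -
  -- x)/2).
  set b : ℕ → ℝ := fun N => ∑ i ∈ Finset.range (N + 1),
    tailSum q i * ((1 - r) * r ^ (N - i)) with hb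
  have hb0 : ∀ N, 0 ≤ b N := fun N => Finset.sum_nonneg fun i _ =>
    mul_nonneg (tailSum_nonneg q i) (mul_nonneg (by linarith) (by positivity))
  have hgeo : Summable fun m : ℕ => (1 - r) * r ^ m :=
    (summable_geometric_of_lt_one hr0 hr1).mul_left _
  have hbs : Summable b :=
    (summable_norm_sum_mul_range_of_summable_norm hQs.norm hgeo.norm).of_norm
  have hbx : ∀ x ∈ Set.Icc (0 : ℝ) 1,
      HasSum (fun N => b N * x ^ N) (exponentDensity ν lam (1 - x)) := by
    intro x hx
    have hx0 := hx.1
    have hpow : ∀ (c : ℕ → ℝ), (∀ i, 0 ≤ c i) → Summable c → Summable fun i => c i * x ^ i :=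
      fun c hc hcs => Summable.of_nonneg_of_le (fun i => mul_nonneg (hc i) (by positivity))
        (fun i => mul_le_of_le_one_right (hc i) (pow_le_one₀ hx.1 hx.2)) hcs
    have e := tsum_mul_tsum_eq_tsum_sum_range_of_summable_norm
      (hpow _ (tailSum_nonneg q) hQs).norm
      (hpow _ (fun m => mul_nonneg (by linarith) (by positivity)) hgeo).norm
    have e1 : ∀ N, ∑ i ∈ Finset.range (N + 1),
        tailSum q i * x ^ i * ((1 - r) * r ^ (N - i) * x ^ (N - i)) = b N * x ^ N := fun N => by
      rw [hb, Finset.sum_mul]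
      refine Finset.sum_congr rfl fun i hi => ?_
      rw [← Nat.add_sub_cancel' (Nat.lt_succ_iff.1 (Finset.mem_range.1 hi)), pow_add]
      simp only [Nat.add_sub_cancel_left]
      ring
    have hrx : r * x < 1 := by nlinarith [hx.2]
    have e2 : ∑' m : ℕ, (1 - r) * r ^ m * x ^ m = (1 + ν / 2 * (1 - x))⁻¹ := by
      have e3 : ∀ m : ℕ, (1 - r) * r ^ m * x ^ m = (1 - r) * (r * x) ^ m := fun m => by
        rw [mul_pow, mul_assoc]
      have h3 := one_add_half_mul_pos ν (hflip hx).1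
      simp only [e3]
      rw [tsum_mul_left, tsum_geometric_of_lt_one (by positivity) hrx, ← div_eq_mul_inv,
        div_eq_iff (by linarith), inv_mul_eq_div, eq_div_iff h3.ne', hr]
      field_simp
      ring
    rw [hQI x hx, e2] at e
    simp only [e1] at e
    rw [exponentDensity, div_eq_mul_inv, e]
    exact (hpow _ hb0 hbs).hasSum
  have e1 : limitExponent ν lam (1 - s) = ∫ x in s..1, exponentDensity ν lam (1 - x) := by
    rw [intervalIntegral.integral_comp_sub_left (exponentDensity ν lam) 1, sub_self, limitExponent]
  have hsub : Set.uIoc s 1 ⊆ Set.Icc (0 : ℝ) 1 := by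
    rw [Set.uIoc_of_le hs.2]
    exact fun u hu => ⟨hs.1.trans hu.1.le, hu.2⟩
  have e2 : HasSum (fun N => ∫ x in s..1, b N * x ^ N)
      (∫ x in s..1, exponentDensity ν lam (1 - x)) := by
    refine intervalIntegral.hasSum_integral_of_dominated_convergence
      (fun N _ => b N) (fun N => ?_) (fun N => ae_of_all _ fun u hu => ?_)
      (ae_of_all _ fun _ _ => hbs) (by simp) (ae_of_all _ fun u hu => hbx u (hsub hu))
    · exact Continuous.aestronglyMeasurable (by fun_prop)
    · rw [Real.norm_of_nonneg (mul_nonneg (hb0 N) (pow_nonneg (hsub hu).1 _))]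
      exact mul_le_of_le_one_right (hb0 N) (pow_le_one₀ (hsub hu).1 (hsub hu).2)
  rw [e1]
  have e3 : ∀ N, coeffA ν q (N + 1) * (s ^ (N + 1) - 1) = -∫ x in s..1, b N * x ^ N := fun N => by
    rw [coeffA_succ_eq ν hq, intervalIntegral.integral_const_mul, integral_pow, one_pow]
    ring
  simpa only [e3] using e2.neg

variable {Ω : Type*} [MeasurableSpace Ω] {P : Measure Ω} [IsProbabilityMeasure P]
  {ξ : ℕ → ℕ → Ω → ℕ} {ε : ℕ → Ω → ℕ}

lemma ImmigrationMoments.tendsto_one_sub_pgf_div (hε : ∀ n, Measurable (ε n))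
    (hoff : NearlyCriticalOffspring P ξ ν) (hlam : Summable fun k => (lam (k + 1) : ℝ))
    (h : ImmigrationMoments P ξ ε lam) {x : ℝ} (hx : x ∈ Set.Icc (0 : ℝ) 1) :
    Tendsto (fun n => (1 - pgf P (ε n) (1 - x)) / (meanDefect P ξ n).toReal) atTop
      (𝓝 (x * alternatingSeries lam x)) := by
  rw [Metric.tendsto_nhds]
  intro τ hτ
  filter_upwards [h.eventually_abs_one_sub_pgf_sub_le hε hoff hlam (half_pos hτ)] with n hn
  have hd := hoff.defect_pos n
  have hn := hn x hx
  set d := (meanDefect P ξ n).toReal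
  rw [Real.dist_eq, ← mul_lt_mul_iff_left₀ hd, ← abs_of_pos hd, ← abs_mul, abs_of_pos hd, sub_mul,
    div_mul_cancel₀ _ hd.ne', mul_comm _ d]
  have : τ / 2 * d * x ≤ τ / 2 * d * 1 := mul_le_mul_of_nonneg_left hx.2 (by positivity)
  have : 0 < τ * d := by positivity
  linarith

/-- The generating function of P(ε_n = j) / d_n over j ≥ 1 is the difference of (1 - g_n) / d_n at 1
and at 1 - s, so it converges; at s = 1 this also bounds the masses. The coefficients then converge
one by one. -/
lemma ImmigrationMoments.exists_limits (hε : ∀ n, Measurable (ε n))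
    (hoff : NearlyCriticalOffspring P ξ ν) (hlam : Summable fun k => (lam (k + 1) : ℝ))
    (h : ImmigrationMoments P ξ ε lam) :
    ∃ q : ℕ → ℝ≥0,
      (∀ j, 1 ≤ j →
        Tendsto (fun n => P {ω | ε n ω = j} / meanDefect P ξ n) atTop (𝓝 (q j : ℝ≥0∞))) ∧
      Summable (fun j => (q (j + 1) : ℝ)) ∧
      ∀ x ∈ Set.Icc (0 : ℝ) 1, ∑' j, (q (j + 1) : ℝ) * x ^ (j + 1) =
        alternatingSeries lam 1 - (1 - x) * alternatingSeries lam (1 - x) := by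
  have hflip : ∀ {x : ℝ}, x ∈ Set.Icc (0 : ℝ) 1 → 1 - x ∈ Set.Icc (0 : ℝ) 1 := fun hx =>
    ⟨by linarith [hx.2], by linarith [hx.1]⟩
  set d : ℕ → ℝ := fun n => (meanDefect P ξ n).toReal
  have hd : ∀ n, 0 < d n := hoff.defect_pos
  -- The atom at 0 is removed, since P(ε_n = 0) / d_n tends to infinity.
  set a : ℕ → ℕ → ℝ := fun n k => if k = 0 then 0 else P.real {ω | ε n ω = k} / d n with ha
  have ha0 : ∀ n k, 0 ≤ a n k := fun n k => by
    simp only [ha]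
    split_ifs
    · exact le_rfl
    · exact div_nonneg measureReal_nonneg (hd n).le
  have hsum : ∀ n, ∀ s ∈ Set.Icc (0 : ℝ) 1,
      HasSum (fun k => a n k * s ^ k) ((pgf P (ε n) s - pgf P (ε n) 0) / d n) := by
    intro n s hs
    have := ((hasSum_pgf (P := P) (hε n) hs).sub
      (hasSum_pgf (P := P) (hε n) (s := 0) (by simp))).div_const (d n)
    have e : ∀ k, a n k * s ^ k =
        (P.real {ω | ε n ω = k} * s ^ k - P.real {ω | ε n ω = k} * 0 ^ k) / d n := fun k => by
      rcases Nat.eq_zero_or_pos k with rfl | hk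
      · simp [ha]
      · simp only [ha, if_neg hk.ne', zero_pow hk.ne']
        ring
    simpa only [e] using this
  have hlim : ∀ s ∈ Set.Icc (0 : ℝ) 1, Tendsto (fun n => ∑' k, a n k * s ^ k) atTop
      (𝓝 (alternatingSeries lam 1 - (1 - s) * alternatingSeries lam (1 - s))) := by
    intro s hs
    have h1 := h.tendsto_one_sub_pgf_div hε hoff hlam (x := 1) (by simp)
    have h2 := h.tendsto_one_sub_pgf_div hε hoff hlam (hflip hs)
    rw [one_mul] at h1
    refine (h1.sub h2).congr fun n => ?_
    rw [(hsum n s hs).tsum_eq, sub_self, sub_sub_cancel]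
    ring
  have hC : ∀ᶠ n in atTop, Summable (a n) ∧ ∑' k, a n k ≤ alternatingSeries lam 1 + 1 := by
    have h1 := hlim 1 (by simp)
    simp only [one_pow, mul_one, sub_self, zero_mul, sub_zero] at h1
    filter_upwards [h1.eventually_le_const (lt_add_one _)] with n hn
    exact ⟨by simpa using (hsum n 1 (by simp)).summable, hn⟩
  obtain ⟨p, hp, hp0, hps, -, hpH⟩ := exists_tendsto_coeff ha0 hC
    fun s hs => hlim s (Set.Ioo_subset_Icc_self hs)
  have hpz : p 0 = 0 := tendsto_nhds_unique (hp 0) (by simp [ha])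
  have hAc : ContinuousOn (alternatingSeries lam) (Set.Icc 0 1) :=
    continuousOn_alternatingSeries hlam
  have hAc' : ContinuousOn (fun s => alternatingSeries lam 1 -
      (1 - s) * alternatingSeries lam (1 - s)) (Set.Icc 0 1) := by
    refine continuousOn_const.sub (ContinuousOn.mul (by fun_prop) ?_)
    exact hAc.comp (by fun_prop) fun x hx => hflip hx
  have heq := eqOn_Icc_of_eqOn_Ioo (continuousOn_tsum_mul_pow hp0 hps) hAc'
    fun s hs => (hpH s hs).tsum_eq
  refine ⟨fun j => ⟨p j, hp0 j⟩, fun j hj => ?_, (summable_nat_add_iff 1).2 hps, fun x hx => ?_⟩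
  · have h1 := ENNReal.tendsto_ofReal (hp j)
    rw [ENNReal.ofReal_eq_coe_nnreal (hp0 j)] at h1
    refine h1.congr fun n => ?_
    simp only [ha, if_neg (by omega : j ≠ 0)]
    rw [ENNReal.ofReal_div_of_pos (hd n), ofReal_measureReal,
      ENNReal.ofReal_toReal (meanDefect_ne_top P ξ n)]
  · have h1 : Summable fun k => p k * x ^ k :=
      Summable.of_nonneg_of_le (fun k => mul_nonneg (hp0 k) (pow_nonneg hx.1 _))
        (fun k => mul_le_of_le_one_right (hp0 k) (pow_le_one₀ hx.1 hx.2)) hps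
    have h2 := heq hx
    simp only [h1.tsum_eq_zero_add, hpz, zero_mul, zero_add] at h2
    exact h2

lemma Model.hasCompoundPoissonForm (hmodel : Model P ξ ε) (hoff : NearlyCriticalOffspring P ξ ν)
    (hlam : Summable fun k => (lam (k + 1) : ℝ)) (h : ImmigrationMoments P ξ ε lam) :
    HasCompoundPoissonForm P ξ ε ν fun s => Real.exp (-limitExponent ν lam (1 - s)) := by
  obtain ⟨q, hq, hqs, hqx⟩ := h.exists_limits hmodel.measurable_immigration hoff hlam
  refine ⟨q, hq, hqs, fun s hs => ?_⟩
  have := hasSum_coeffA ν hlam hqs hqx hs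
  exact ⟨this.summable, by rw [this.tsum_eq]⟩

end NearlyCritical

/-! ### Reduction of the two immigration conditions to one -/

namespace NearlyCritical

variable {Ω : Type*} [MeasurableSpace Ω] {P : Measure Ω}
  {ξ : ℕ → ℕ → Ω → ℕ} {ε : ℕ → Ω → ℕ} {ν : ℝ≥0} {lam : ℕ → ℝ≥0}

lemma summable_of_rootLimsup_lt_one (h : rootLimsup lam < 1) : Summable fun k => (lam k : ℝ) := by
  obtain ⟨r, hr, hr1⟩ := ENNReal.lt_iff_exists_nnreal_btwn.1 h
  have hr1 : r < 1 := by exact_mod_cast hr1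
  have hev := eventually_lt_of_limsup_lt hr
  have hb : ∀ᶠ n in atTop, ‖(lam n : ℝ)‖ ≤ (r : ℝ) ^ n := by
    filter_upwards [hev, eventually_ge_atTop 1] with n hn hn1
    have hn0 : (0 : ℝ) < n := by exact_mod_cast hn1
    have h1 : (lam n : ℝ≥0∞) ≤ (r : ℝ≥0∞) ^ (n : ℝ) := by
      have := ENNReal.rpow_le_rpow hn.le hn0.le
      rwa [← ENNReal.rpow_mul, one_div_mul_cancel hn0.ne', ENNReal.rpow_one] at this
    rw [ENNReal.rpow_natCast] at h1
    rw [Real.norm_of_nonneg (NNReal.coe_nonneg _)]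
    exact_mod_cast h1
  exact Summable.of_norm_bounded_eventually_nat
    (summable_geometric_of_lt_one r.coe_nonneg (by exact_mod_cast hr1)) hb

lemma InfiniteImmigration.immigrationMoments (h : InfiniteImmigration P ξ ε lam) : ImmigrationMoments P ξ ε lam := by
  intro τ hτ
  have h1 := tendsto_sum_nat_add fun k => (lam k : ℝ)
  obtain ⟨K, hK, hK1⟩ := ((h1.eventually_le_const hτ).and (eventually_ge_atTop 1)).exists
  exact ⟨K, hK1, fun k hk _ => h.limit k hk, hK⟩

/-- The sequence `lam`, set to `0` from the index `K` on. -/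
def truncate (lam : ℕ → ℝ≥0) (K k : ℕ) : ℝ≥0 := if k < K then lam k else 0

/-- Since λ_K = 0, truncation at K does not alter the limit of order K, and the truncated sequence
has zero tail from K on. The same K therefore serves every τ. -/
lemma FiniteImmigration.immigrationMoments {K : ℕ} (h : FiniteImmigration P ξ ε lam K) :
    ImmigrationMoments P ξ ε (truncate lam K) := by
  intro τ hτ
  refine ⟨K, h.one_le, fun k hk hkK => ?_, ?_⟩
  · have h1 := h.limit k hk hkK
    rcases hkK.lt_or_eq with hlt | rfl
    · simpa only [truncate, if_pos hlt] using h1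
    · simpa only [truncate, lt_irrefl, if_false, h.last] using h1
  · simpa [truncate] using hτ.le

lemma summable_truncate (lam : ℕ → ℝ≥0) (K : ℕ) :
    Summable fun k => (truncate lam K (k + 1) : ℝ) :=
  summable_of_ne_finset_zero (s := Finset.range K) fun k hk => by
    have : ¬ k + 1 < K := by have := Finset.mem_range.not.1 hk; omega
    simp [truncate, this]

lemma limitExponent_truncate (ν : ℝ≥0) (lam : ℕ → ℝ≥0) (K : ℕ) {s : ℝ}
    (hs : s ∈ Set.Icc (0 : ℝ) 1) :
    limitExponent ν (truncate lam K) (1 - s) =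
      ∑ k ∈ Finset.Ico 1 K, logTerm ν lam k s := by
  have h := hasSum_logTerm ν (summable_truncate lam K) hs
  rw [← h.tsum_eq, Finset.sum_Ico_eq_sum_range, tsum_eq_sum (s := Finset.range (K - 1))]
  · refine Finset.sum_congr rfl fun k hk => ?_
    have hk : k + 1 < K := by have := Finset.mem_range.1 hk; omega
    rw [add_comm 1 k]
    simp only [logTerm, truncate, if_pos hk]
  · intro k hk
    have hk : ¬ k + 1 < K := by have := Finset.mem_range.not.1 hk; omega
    simp [logTerm, truncate, if_neg hk]

lemma HasLimitPGF.congr [IsProbabilityMeasure P] {f g : ℝ → ℝ} (h : HasLimitPGF P ξ ε f)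
    (hfg : ∀ s ∈ Set.Icc (0 : ℝ) 1, f s = g s) : HasLimitPGF P ξ ε g := by
  obtain ⟨μ, hμ, h1, h2⟩ := h
  exact ⟨μ, hμ, h1, fun s hs => (h2 s hs).trans (hfg s hs)⟩

lemma HasCompoundPoissonForm.congr {f g : ℝ → ℝ} (h : HasCompoundPoissonForm P ξ ε ν f)
    (hfg : ∀ s ∈ Set.Icc (0 : ℝ) 1, f s = g s) : HasCompoundPoissonForm P ξ ε ν g := by
  obtain ⟨q, h1, h2, h3⟩ := h
  exact ⟨q, h1, h2, fun s hs => ⟨(h3 s hs).1, (hfg s hs).symm.trans (h3 s hs).2⟩⟩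

variable [IsProbabilityMeasure P]

theorem Model.limit_of_finiteImmigration (hmodel : Model P ξ ε)
    (hoff : NearlyCriticalOffspring P ξ ν) {K : ℕ} (hK : FiniteImmigration P ξ ε lam K) :
    HasLimitPGF P ξ ε (fun s => Real.exp (-∑ k ∈ Finset.Ico 1 K, logTerm ν lam k s)) ∧
      HasCompoundPoissonForm P ξ ε ν
        (fun s => Real.exp (-∑ k ∈ Finset.Ico 1 K, logTerm ν lam k s)) := by
  have hlam := summable_truncate lam K
  have hfg : ∀ s ∈ Set.Icc (0 : ℝ) 1,
      Real.exp (-limitExponent ν (truncate lam K) (1 - s)) =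
        Real.exp (-∑ k ∈ Finset.Ico 1 K, logTerm ν lam k s) := fun s hs => by
    rw [limitExponent_truncate ν lam K hs]
  exact ⟨(hmodel.hasLimitPGF hoff hlam hK.immigrationMoments).congr hfg,
    (hmodel.hasCompoundPoissonForm hoff hlam hK.immigrationMoments).congr hfg⟩

theorem Model.limit_of_infiniteImmigration (hmodel : Model P ξ ε)
    (hoff : NearlyCriticalOffspring P ξ ν) (hI : InfiniteImmigration P ξ ε lam)
    (hroot : rootLimsup lam < 1) :
    (∀ s ∈ Set.Icc (0 : ℝ) 1, Summable (fun k => logTerm ν lam (k + 1) s)) ∧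
      HasLimitPGF P ξ ε (fun s => Real.exp (-∑' k, logTerm ν lam (k + 1) s)) ∧
      HasCompoundPoissonForm P ξ ε ν
        (fun s => Real.exp (-∑' k, logTerm ν lam (k + 1) s)) := by
  have hlam' := summable_of_rootLimsup_lt_one hroot
  have hlam : Summable fun k => (lam (k + 1) : ℝ) := (summable_nat_add_iff 1).2 hlam'
  have hfg : ∀ s ∈ Set.Icc (0 : ℝ) 1, Real.exp (-limitExponent ν lam (1 - s)) =
      Real.exp (-∑' k, logTerm ν lam (k + 1) s) := fun s hs => by
    rw [(hasSum_logTerm ν hlam hs).tsum_eq]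
  exact ⟨fun s hs => (hasSum_logTerm ν hlam hs).summable,
    (hmodel.hasLimitPGF hoff hlam hI.immigrationMoments).congr hfg,
    (hmodel.hasCompoundPoissonForm hoff hlam hI.immigrationMoments).congr hfg⟩

end NearlyCritical

theorem theorem4 {Ω : Type*} [MeasurableSpace Ω] (P : MeasureTheory.Measure Ω)
    [MeasureTheory.IsProbabilityMeasure P] (ξ : ℕ → ℕ → Ω → ℕ) (ε : ℕ → Ω → ℕ)
    (ν : ℝ≥0) (lam : ℕ → ℝ≥0)
    (hmodel : NearlyCritical.Model P ξ ε)
    (hoff : NearlyCritical.NearlyCriticalOffspring P ξ ν) :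
    (∀ K : ℕ, NearlyCritical.FiniteImmigration P ξ ε lam K →
      NearlyCritical.HasLimitPGF P ξ ε
        (fun s => Real.exp (-∑ k ∈ Finset.Ico 1 K, NearlyCritical.logTerm ν lam k s)) ∧
      NearlyCritical.HasCompoundPoissonForm P ξ ε ν
        (fun s => Real.exp (-∑ k ∈ Finset.Ico 1 K, NearlyCritical.logTerm ν lam k s))) ∧
    (NearlyCritical.InfiniteImmigration P ξ ε lam → NearlyCritical.rootLimsup lam ≤ 1 / 2 →
      (∀ s ∈ Set.Icc (0 : ℝ) 1,
        Summable (fun k => NearlyCritical.logTerm ν lam (k + 1) s)) ∧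
      NearlyCritical.HasLimitPGF P ξ ε
        (fun s => Real.exp (-∑' k, NearlyCritical.logTerm ν lam (k + 1) s)) ∧
      NearlyCritical.HasCompoundPoissonForm P ξ ε ν
        (fun s => Real.exp (-∑' k, NearlyCritical.logTerm ν lam (k + 1) s))) := by
  refine ⟨fun K hK => hmodel.limit_of_finiteImmigration hoff hK, fun hI hroot =>
    hmodel.limit_of_infiniteImmigration hoff hI (hroot.trans_lt ?_)⟩
  exact ENNReal.half_lt_self one_ne_zero ENNReal.one_ne_top
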